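/- Let $\Omega\subset\mathbb R^{n_0}$ be a bounded domain, $r>0$, $d\ge 0$, $C=C([-r,0];L^2(\Omega))$ with the maximum norm ($L^2(\Omega)$ real), and let $A:D(A)\subset L^2(\Omega)\to L^2(\Omega)$ be a densely defined, self-adjoint, positive ($\langle Av,v\rangle\ge 0$ for $v\in D(A)$) linear operator with compact resolvent; $e^{-At}$, $t\ge0$, is the semigroup generated by $-A$. Let $B:L^2(\Omega)\to L^2(\Omega)$ be Lipschitz continuous, let $\eta:C\to[0,r]$ be continuous, put $F(\varphi)=B(\varphi(-\eta(\varphi)))$ for $\varphi\in C$, and write $u_t(\theta)=u(t+\theta)$, $\theta\in[-r,0]$. Consider the initial value problem $$\frac{d}{dt}u(t)+Au(t)+d\,u(t)=F(u_t),\quad t>0,\qquad u|_{[-r,0]}=\varphi\in C. \tag{1}$$ A mild solution of (1) on $[-r,T]$ is a function $u\in C([-r,T];L^2(\Omega))$ with $u|_{[-r,0]}=\varphi$ and $$u(t)=e^{-At}\varphi(0)+\int_0^t e^{-A(t-s)}\{F(u_s)-d\,u(s)\}\,ds,\qquad t\in[0,T];$$ a global mild solution is a $u\in C([-r,\infty);L^2(\Omega))$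 that is a mild solution on $[-r,T]$ for every $T\ge0$. Let $\Theta^u,\Theta^\ell:C\to[0,r]$ be continuous with $0<\Theta^\ell(\varphi)\le\Theta^u(\varphi)$ for all $\varphi\in C$, and assume that for all $\varphi,\psi\in C$ $$\psi(\theta)=\varphi(\theta)\ \text{ for all }\theta\in[-\Theta^u(\varphi),-\Theta^\ell(\varphi)]\ \Longrightarrow\ \eta(\psi)=\eta(\varphi). \tag{$\widehat H$}$$ Then for every $\varphi\in C$ problem (1) has a global mild solution $u$, and it is unique: every mild solution on an interval $[-r,T]$, $T\ge 0$, coincides with $u$ there. Moreover, the evolution operators $S_t:C\to C$, $S_t\varphi=u_t$ for $t\ge0$, form a dynamical system on $C$: 1. $S_0=\mathrm{Id}$; 2. $S_tS_\tau=S_{t+\tau}$ for all $t,\tau\ge0$; 3. for every $\varphi\in C$ the map $t\mapsto S_t\varphi$ is continuous from $[0,\infty)$ to $C$; 4. for every $t\ge0$ the map $S_t:C\to C$ is continuous. -/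

import Mathlib

open MeasureTheory Set
open scoped NNReal

noncomputable section

namespace DelayEq

section Operators

variable {H : Type*} [NormedAddCommGroup H] [InnerProductSpace ℝ H]

/-- A (possibly unbounded) operator is positive if `⟪A x, x⟫ ≥ 0` on its domain. -/
def IsPositiveOp (A : H →ₗ.[ℝ] H) : Prop :=
  ∀ x : A.domain, 0 ≤ inner ℝ (A x) (x : H)

/-- `A` has compact resolvent: for some `z` in the resolvent set of `A` the resolvent
`R = (A - z)⁻¹`, a bounded operator defined on all of `H`, is compact. -/
def HasCompactResolvent (A : H →ₗ.[ℝ] H) : Prop :=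
  ∃ (z : ℝ) (R : H →L[ℝ] H), IsCompactOperator R ∧
    (∀ y : H, ∃ h : R y ∈ A.domain, A ⟨R y, h⟩ - z • R y = y) ∧
    (∀ x : A.domain, R (A x - z • (x : H)) = x)

/-- The space of all `x` in the domain of `A` with `A x = μ x`, written through the graph. -/
def eigenspace (A : H →ₗ.[ℝ] H) (μ : ℝ) : Submodule ℝ H :=
  A.graph.comap (LinearMap.id.prod (μ • LinearMap.id))

theorem mem_eigenspace {A : H →ₗ.[ℝ] H} {μ : ℝ} {x : H} :
    x ∈ eigenspace A μ ↔ ∃ h : x ∈ A.domain, A ⟨x, h⟩ = μ • x := by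
  simp [eigenspace, LinearPMap.mem_graph_iff]

/-- The operator `e^{-tA}` of a self-adjoint operator `A` with compact resolvent, by its spectral
decomposition: `e^{-tA} x = ∑ e^{-tμ} P_μ x`, where `P_μ` is the orthogonal projection onto the
eigenspace of `A` for `μ` (which is `0` unless `μ` is an eigenvalue).
Eigenspaces of a self-adjoint operator are closed; the closure is taken
only so that the projection makes sense for every `A`. -/
def expNeg [CompleteSpace H] (A : H →ₗ.[ℝ] H) (t : ℝ) (x : H) : H :=
  ∑' μ : ℝ, Real.exp (-(t * μ)) • (eigenspace A μ).topologicalClosure.starProjection x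

end Operators

section Delay

/-- The phase space `C = C([-r,0]; H)` with the maximum norm. -/
abbrev Hist (r : ℝ≥0) (H : Type*) [TopologicalSpace H] : Type _ :=
  C(Icc (-(r : ℝ)) 0, H)

variable {H : Type*} [NormedAddCommGroup H] {r : ℝ≥0}

/-- The value `φ(0)`. -/
def atZero (φ : Hist r H) : H := φ ⟨0, by simp⟩

/-- The delay term `F(φ) = B(φ(-η(φ)))`. -/
def delayTerm (B : H → H) (η : Hist r H → Icc (0 : ℝ) r) (φ : Hist r H) : H :=
  B (φ ⟨-(η φ : ℝ), neg_le_neg (η φ).2.2, neg_nonpos.2 (η φ).2.1⟩)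

open Classical in
/-- The segment `u_t ∈ C`, `u_t(θ) = u(t + θ)`, of a function that is continuous on
`[t - r, t]` (and `0` for other functions). -/
def segment (r : ℝ≥0) (u : ℝ → H) (t : ℝ) : Hist r H :=
  if h : Continuous (fun θ : Icc (-(r : ℝ)) 0 => u (t + θ)) then ⟨_, h⟩ else 0

/-- The state-dependent condition on the delay: `η` ignores the values of its argument `φ`
outside `[-Θu(φ), -Θl(φ)]`. -/
def IgnoresOutside (η Θu Θl : Hist r H → Icc (0 : ℝ) r) : Prop :=
  ∀ φ ψ : Hist r H,
    (∀ θ : Icc (-(r : ℝ)) 0, (θ : ℝ) ∈ Icc (-(Θu φ : ℝ)) (-(Θl φ : ℝ)) → ψ θ = φ θ) →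
      η ψ = η φ

variable [InnerProductSpace ℝ H] [CompleteSpace H]

/-- `u` is a mild solution on `[-r,T]` of `u' + A u + d u = B(u(t - η(u_t)))`, `u = φ` on
`[-r,0]`. Only the values of `u` on `[-r,T]` matter. -/
structure IsMildSolutionOn (A : H →ₗ.[ℝ] H) (d : ℝ) (B : H → H) (η : Hist r H → Icc (0 : ℝ) r)
    (φ : Hist r H) (T : ℝ) (u : ℝ → H) : Prop where
  continuousOn : ContinuousOn u (Icc (-(r : ℝ)) T)
  initial : ∀ θ : Icc (-(r : ℝ)) 0, u θ = φ θ
  integral_eq : ∀ t ∈ Icc 0 T, u t = expNeg A t (atZero φ) +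
    ∫ s in (0 : ℝ)..t, expNeg A (t - s) (delayTerm B η (segment r u s) - d • u s)

/-- `u` is a global mild solution: `u ∈ C([-r,∞); H)` is a mild solution on every `[-r,T]`. -/
def IsGlobalMildSolution (A : H →ₗ.[ℝ] H) (d : ℝ) (B : H → H) (η : Hist r H → Icc (0 : ℝ) r)
    (φ : Hist r H) (u : ℝ → H) : Prop :=
  ContinuousOn u (Ici (-(r : ℝ))) ∧ ∀ T : ℝ, 0 ≤ T → IsMildSolutionOn A d B η φ T u

end Delay

/-- `(S_t)_{t ≥ 0}` is a dynamical system on `X`. -/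
structure IsDynamicalSystem {X : Type*} [TopologicalSpace X] (S : ℝ≥0 → X → X) : Prop where
  zero : S 0 = id
  add : ∀ t τ : ℝ≥0, S t ∘ S τ = S (t + τ)
  continuous_time : ∀ x : X, Continuous (fun t : ℝ≥0 => S t x)
  continuous_state : ∀ t : ℝ≥0, Continuous (S t)

end DelayEq

end

/-! The delay `η` is only continuous, so `φ ↦ F(φ)` need not be Lipschitz and the usual contraction
argument does not apply directly. Condition (Ĥ) repairs this. As `Θl > 0`, for a short time `δ` the
delay along a trajectory from `ψ` reads only values at times `≤ 0`, so it equals the known function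
`s ↦ η (freeze ψ s)` (`LocallyFrozen`). With the delay prescribed, the forcing is Lipschitz in `u`
with constant `L + d`, and a contraction gives local existence
(`LocallyFrozen.exists_isMildSolutionOn`). By continuity of `Θl`, one `δ` serves a neighbourhood of
each history (`HasUniformStep`).

Two solutions with nearby histories differ by the distance of the histories plus the effect of the
two frozen delays (`norm_sub_le_of_locallyFrozen`). For equal histories this gives uniqueness. For
convergent histories it gives short-time continuity, since `η` is continuous. Linear growth of `B`
excludes blow-up, so local solutions continue for all time. The semigroup law follows from
uniqueness, and it carries continuity of `S_t` from short times to all times.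

The operators `e^{-tA}` are handled through their spectral series: compactness of the resolvent
makes eigenvectors span a dense subspace, and positivity makes the operators contractions. -/

open Filter Topology

noncomputable section

namespace DelayEq

/-! ### The contraction semigroup from the spectral decomposition. -/

section Semigroup

variable {H : Type*} [NormedAddCommGroup H] [InnerProductSpace ℝ H]

/-- A strongly continuous semigroup of contractions; its values at negative times are irrelevant,
but it is contractive and continuous there as well. -/
structure IsContractionSemigroup (E : ℝ → H →L[ℝ] H) : Prop where
  zero : ∀ x, E 0 x = x
  add : ∀ s t, 0 ≤ s → 0 ≤ t → ∀ x, E (s + t) x = E s (E t x)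
  norm_le : ∀ t x, ‖E t x‖ ≤ ‖x‖
  continuous : ∀ x, Continuous fun t => E t x

theorem IsContractionSemigroup.continuous_uncurry {E : ℝ → H →L[ℝ] H}
    (hE : IsContractionSemigroup E) : Continuous fun p : ℝ × H => E p.1 p.2 := by
  refine continuous_iff_continuousAt.2 fun ⟨t₀, x₀⟩ => ?_
  have h1 : Tendsto (fun p : ℝ × H => E p.1 x₀) (𝓝 (t₀, x₀)) (𝓝 (E t₀ x₀)) :=
    ((hE.continuous x₀).comp continuous_fst).tendsto (t₀, x₀)
  -- Contractivity is uniform in time, so moving the vector costs at most `‖p.2 - x₀‖`.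
  have h2 : Tendsto (fun p : ℝ × H => E p.1 (p.2 - x₀)) (𝓝 (t₀, x₀)) (𝓝 0) := by
    refine squeeze_zero_norm (fun p => hE.norm_le p.1 (p.2 - x₀)) ?_
    have : Continuous fun p : ℝ × H => ‖p.2 - x₀‖ := by fun_prop
    simpa using this.tendsto (t₀, x₀)
  have h3 := h1.add h2
  simp only [add_zero, ← map_add, add_sub_cancel] at h3
  exact h3

theorem inner_eigenspace_eq_zero {A : H →ₗ.[ℝ] H} (hA : A.IsFormalAdjoint A)
    {μ ν : ℝ} (h : μ ≠ ν) {x y : H} (hx : x ∈ eigenspace A μ) (hy : y ∈ eigenspace A ν) :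
    inner ℝ x y = 0 := by
  obtain ⟨hx, hAx⟩ := mem_eigenspace.1 hx
  obtain ⟨hy, hAy⟩ := mem_eigenspace.1 hy
  have := hA ⟨x, hx⟩ ⟨y, hy⟩
  rw [hAx, hAy, inner_smul_left, inner_smul_right] at this
  have h2 : (μ - ν) * inner ℝ x y = 0 := by
    simp only [conj_trivial] at this
    linarith
  exact (mul_eq_zero.1 h2).resolve_left (sub_ne_zero.2 h)

theorem eigenspace_eq_bot_of_neg {A : H →ₗ.[ℝ] H} (hA : IsPositiveOp A) {μ : ℝ} (hμ : μ < 0) :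
    eigenspace A μ = ⊥ := by
  refine (Submodule.eq_bot_iff _).2 fun x hx => ?_
  obtain ⟨hx, hAx⟩ := mem_eigenspace.1 hx
  have := hA ⟨x, hx⟩
  rw [hAx, inner_smul_left, real_inner_self_eq_norm_sq] at this
  by_contra h0
  have : 0 < ‖x‖ ^ 2 := by positivity
  simp only [conj_trivial] at *
  nlinarith

theorem inner_closure_eigenspace_eq_zero {A : H →ₗ.[ℝ] H} (hA : A.IsFormalAdjoint A)
    {μ ν : ℝ} (h : μ ≠ ν) {x y : H} (hx : x ∈ (eigenspace A μ).topologicalClosure)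
    (hy : y ∈ (eigenspace A ν).topologicalClosure) : inner ℝ x y = 0 := by
  have h1 : (eigenspace A μ).topologicalClosure ⟂ (eigenspace A ν).topologicalClosure := by
    have h2 : eigenspace A ν ⟂ eigenspace A μ := fun y hy => (Submodule.mem_orthogonal _ _).2
      fun x hx => inner_eigenspace_eq_zero hA h hx hy
    have h3 : (eigenspace A ν).topologicalClosure ⟂ eigenspace A μ :=
      Submodule.topologicalClosure_minimal _ h2 (Submodule.isClosed_orthogonal _)
    exact Submodule.topologicalClosure_minimal _ h3.symm (Submodule.isClosed_orthogonal _)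
  exact Submodule.IsOrtho.inner_eq h1 hx hy

theorem orthogonalFamily_closure_eigenspace {A : H →ₗ.[ℝ] H} (hA : A.IsFormalAdjoint A) :
    OrthogonalFamily ℝ (fun μ => (eigenspace A μ).topologicalClosure)
      fun μ => (eigenspace A μ).topologicalClosure.subtypeₗᵢ :=
  fun _ _ h x y => inner_closure_eigenspace_eq_zero hA h x.2 y.2

variable [CompleteSpace H]

/-- Symmetry of `A` makes the compact operator `R` symmetric, so its eigenspaces have trivial
orthogonal complement. An eigenvector of `R` for `c ≠ 0` is one of `A` for `z + c⁻¹`, and `R` has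
trivial kernel. -/
theorem orthogonal_iSup_eigenspace_eq_bot {A : H →ₗ.[ℝ] H} (hA : A.IsFormalAdjoint A)
    (hR : HasCompactResolvent A) : (⨆ μ, eigenspace A μ)ᗮ = ⊥ := by
  obtain ⟨z, R, hRc, h1, h2⟩ := hR
  have hsymm : (R : H →ₗ[ℝ] H).IsSymmetric := by
    intro x y
    obtain ⟨hx, hAx⟩ := h1 x
    obtain ⟨hy, hAy⟩ := h1 y
    have h := hA ⟨R x, hx⟩ ⟨R y, hy⟩
    simp only [ContinuousLinearMap.coe_coe]
    rw [sub_eq_iff_eq_add] at hAx hAy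
    rw [hAx, hAy] at h
    simp only [inner_add_left, inner_add_right, inner_smul_left, inner_smul_right,
      conj_trivial] at h
    linarith
  rw [eq_bot_iff, ← ContinuousLinearMap.orthogonalComplement_iSup_eigenspaces_eq_bot hRc hsymm]
  refine Submodule.orthogonal_le (iSup_le fun c x hx => ?_)
  have hRx : R x = c • x := Module.End.mem_eigenspace_iff.1 hx
  obtain ⟨hmem, hAx⟩ := h1 x
  by_cases hc : c = 0
  · have : R x = 0 := by rw [hRx, hc, zero_smul]
    have hz : (⟨R x, hmem⟩ : A.domain) = 0 := Subtype.ext this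
    rw [hz, this] at hAx
    simp only [LinearPMap.map_zero, smul_zero, sub_zero] at hAx
    rw [← hAx]
    exact Submodule.zero_mem _
  · refine Submodule.mem_iSup_of_mem (z + c⁻¹) (mem_eigenspace.2 ?_)
    have hxeq : x = c⁻¹ • R x := by rw [hRx, inv_smul_smul₀ hc]
    have hxd : x ∈ A.domain := by
      rw [hxeq]; exact A.domain.smul_mem _ hmem
    refine ⟨hxd, ?_⟩
    have he : (⟨x, hxd⟩ : A.domain) = c⁻¹ • ⟨R x, hmem⟩ := Subtype.ext hxeq
    rw [he, LinearPMap.map_smul, sub_eq_iff_eq_add.1 hAx, smul_add, smul_comm, ← hxeq, add_smul,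
      add_comm]

/-- The spectral projection onto (the closure of) an eigenspace. -/
abbrev eigenProj (A : H →ₗ.[ℝ] H) (μ : ℝ) : H →L[ℝ] H :=
  (eigenspace A μ).topologicalClosure.starProjection

theorem eigenProj_mem (A : H →ₗ.[ℝ] H) (μ : ℝ) (x : H) :
    eigenProj A μ x ∈ (eigenspace A μ).topologicalClosure :=
  Submodule.starProjection_apply_mem _ _

theorem norm_sq_sum_smul_eigenProj {A : H →ₗ.[ℝ] H} (hA : A.IsFormalAdjoint A) (c : ℝ → ℝ)
    (s : Finset ℝ) (x : H) :
    ‖∑ μ ∈ s, c μ • eigenProj A μ x‖ ^ 2 = ∑ μ ∈ s, ‖c μ • eigenProj A μ x‖ ^ 2 :=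
  (orthogonalFamily_closure_eigenspace hA).norm_sum
    (fun μ => ⟨c μ • eigenProj A μ x, Submodule.smul_mem _ _ (eigenProj_mem A μ x)⟩) s

/-- Bessel's inequality: the finite sum `y` of projections satisfies `‖y‖² = ⟪x, y⟫ ≤ ‖x‖ ‖y‖`. -/
theorem sum_norm_sq_eigenProj_le {A : H →ₗ.[ℝ] H} (hA : A.IsFormalAdjoint A) (s : Finset ℝ)
    (x : H) : ∑ μ ∈ s, ‖eigenProj A μ x‖ ^ 2 ≤ ‖x‖ ^ 2 := by
  have h1 := norm_sq_sum_smul_eigenProj hA 1 s x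
  simp only [Pi.one_apply, one_smul] at h1
  have h2 : inner ℝ x (∑ μ ∈ s, eigenProj A μ x) = ∑ μ ∈ s, ‖eigenProj A μ x‖ ^ 2 := by
    rw [inner_sum]
    refine Finset.sum_congr rfl fun μ _ => ?_
    have := Submodule.starProjection_inner_eq_zero (K := (eigenspace A μ).topologicalClosure) x _
      (eigenProj_mem A μ x)
    rw [inner_sub_left, sub_eq_zero] at this
    rw [this, real_inner_self_eq_norm_sq]
  have h3 := real_inner_le_norm x (∑ μ ∈ s, eigenProj A μ x)
  rw [h2, ← h1] at h3
  rw [← h1]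
  nlinarith [norm_nonneg x, norm_nonneg (∑ μ ∈ s, eigenProj A μ x)]

theorem norm_exp_smul_eigenProj_le {A : H →ₗ.[ℝ] H} (hA : IsPositiveOp A) {t : ℝ} (ht : 0 ≤ t)
    (μ : ℝ) (x : H) : ‖Real.exp (-(t * μ)) • eigenProj A μ x‖ ≤ ‖eigenProj A μ x‖ := by
  rcases lt_or_ge μ 0 with hμ | hμ
  · have h0 : eigenProj A μ x = 0 := by
      have := eigenProj_mem A μ x
      rw [eigenspace_eq_bot_of_neg hA hμ] at this
      have hcl : (⊥ : Submodule ℝ H).topologicalClosure = ⊥ :=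
        IsClosed.submodule_topologicalClosure_eq isClosed_singleton
      rw [hcl] at this
      exact (Submodule.mem_bot ℝ).1 this
    simp [h0]
  · rw [norm_smul, Real.norm_eq_abs, abs_of_pos (Real.exp_pos _)]
    exact mul_le_of_le_one_left (norm_nonneg _) (Real.exp_le_one_iff.2 (by nlinarith))

section

variable {A : H →ₗ.[ℝ] H} (hA : A.IsFormalAdjoint A) (hpos : IsPositiveOp A)
include hA hpos

theorem summable_exp_smul_eigenProj {t : ℝ} (ht : 0 ≤ t) (x : H) :
    Summable fun μ => Real.exp (-(t * μ)) • eigenProj A μ x := by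
  have h := (orthogonalFamily_closure_eigenspace hA).summable_iff_norm_sq_summable
    (fun μ => ⟨Real.exp (-(t * μ)) • eigenProj A μ x,
      Submodule.smul_mem _ _ (eigenProj_mem A μ x)⟩)
  refine h.2 (summable_of_sum_le (c := ‖x‖ ^ 2) (fun _ => by positivity) fun s => ?_)
  refine le_trans (Finset.sum_le_sum fun μ _ => ?_) (sum_norm_sq_eigenProj_le hA s x)
  exact pow_le_pow_left₀ (norm_nonneg _) (norm_exp_smul_eigenProj_le hpos ht μ x) 2

theorem norm_expNeg_le {t : ℝ} (ht : 0 ≤ t) (x : H) : ‖expNeg A t x‖ ≤ ‖x‖ := by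
  have h := (summable_exp_smul_eigenProj hA hpos ht x).hasSum
  refine le_of_tendsto h.norm (Eventually.of_forall fun s => ?_)
  refine le_of_sq_le_sq ?_ (norm_nonneg x)
  rw [norm_sq_sum_smul_eigenProj hA]
  refine le_trans (Finset.sum_le_sum fun μ _ => ?_) (sum_norm_sq_eigenProj_le hA s x)
  exact pow_le_pow_left₀ (norm_nonneg _) (norm_exp_smul_eigenProj_le hpos ht μ x) 2

/-- `e^{-tA}` as a bounded operator, extended by the identity to negative `t`. -/
def expNegCLM (t : ℝ) : H →L[ℝ] H :=
  LinearMap.mkContinuous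
    { toFun := expNeg A (max t 0)
      map_add' := fun x y => by
        simp only [expNeg, map_add, smul_add]
        exact (summable_exp_smul_eigenProj hA hpos (le_max_right t 0) x).tsum_add
          (summable_exp_smul_eigenProj hA hpos (le_max_right t 0) y)
      map_smul' := fun c x => by
        simp only [expNeg, map_smul, RingHom.id_apply]
        simp_rw [smul_comm _ c]
        exact (summable_exp_smul_eigenProj hA hpos (le_max_right t 0) x).tsum_const_smul c }
    1 fun x => by
      rw [one_mul]
      exact norm_expNeg_le hA hpos (le_max_right t 0) x

theorem expNegCLM_apply {t : ℝ} (ht : 0 ≤ t) (x : H) :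
    expNegCLM hA hpos t x = expNeg A t x := by
  change expNeg A (max t 0) x = _
  rw [max_eq_left ht]

theorem norm_expNegCLM_le (t : ℝ) (x : H) : ‖expNegCLM hA hpos t x‖ ≤ ‖x‖ :=
  norm_expNeg_le hA hpos (le_max_right t 0) x

theorem expNegCLM_apply_of_mem {μ : ℝ} {x : H} (hx : x ∈ eigenspace A μ) (t : ℝ) :
    expNegCLM hA hpos t x = Real.exp (-(max t 0 * μ)) • x := by
  change expNeg A (max t 0) x = _
  have hx' : x ∈ (eigenspace A μ).topologicalClosure := Submodule.le_topologicalClosure _ hx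
  rw [expNeg, tsum_eq_single μ]
  · rw [Submodule.starProjection_eq_self_iff.2 hx']
  · intro ν hν
    have : eigenProj A ν x = 0 := by
      refine Submodule.eq_starProjection_of_mem_of_inner_eq_zero (Submodule.zero_mem _) ?_
      intro w hw
      rw [sub_zero]
      exact inner_closure_eigenspace_eq_zero hA hν.symm hx' hw
    rw [this, smul_zero]

omit hpos in
-- Density of the span of the eigenvectors reduces the semigroup axioms to scalar exponentials.
theorem induction_eigenspace (hR : HasCompactResolvent A) {p : H → Prop}
    (hp0 : ∀ μ, ∀ x ∈ eigenspace A μ, p x) (hadd : ∀ x y, p x → p y → p (x + y))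
    (hcl : IsClosed {x | p x}) (x : H) : p x := by
  have hd : Dense ((⨆ μ, eigenspace A μ : Submodule ℝ H) : Set H) := by
    rw [Submodule.dense_iff_topologicalClosure_eq_top,
      Submodule.topologicalClosure_eq_top_iff]
    exact orthogonal_iSup_eigenspace_eq_bot hA hR
  refine hd.induction (fun y hy => ?_) hcl x
  induction hy using Submodule.iSup_induction' with
  | mem μ y hy => exact hp0 μ y hy
  | zero => exact hp0 0 0 (Submodule.zero_mem _)
  | add y z _ _ hy hz => exact hadd y z hy hz

theorem isContractionSemigroup_expNegCLM (hR : HasCompactResolvent A) :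
    IsContractionSemigroup (expNegCLM hA hpos) where
  zero := by
    refine induction_eigenspace hA hR (fun μ x hx => ?_) (fun x y hx hy => ?_) ?_
    · simp [expNegCLM_apply_of_mem hA hpos hx]
    · rw [map_add, hx, hy]
    · exact isClosed_eq (by fun_prop) continuous_id
  add := by
    intro s t hs ht
    refine induction_eigenspace hA hR (fun μ x hx => ?_) (fun x y hx hy => ?_) ?_
    · rw [expNegCLM_apply_of_mem hA hpos hx, expNegCLM_apply_of_mem hA hpos hx, map_smul,
        expNegCLM_apply_of_mem hA hpos hx, smul_smul, ← Real.exp_add, max_eq_left hs,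
        max_eq_left ht, max_eq_left (add_nonneg hs ht)]
      congr 2
      ring
    · simp only [map_add, hx, hy]
    · exact isClosed_eq (by fun_prop) (by fun_prop)
  norm_le := norm_expNegCLM_le hA hpos
  continuous := by
    refine induction_eigenspace hA hR (fun μ x hx => ?_) (fun x y hx hy => ?_) ?_
    · simp only [expNegCLM_apply_of_mem hA hpos hx]
      fun_prop
    · simp only [map_add]
      exact hx.add hy
    -- Orbits of nearby points are uniformly close in time, so a limit of points with continuous
    -- orbits has a continuous orbit.
    · refine isClosed_of_closure_subset fun x hx => ?_
      refine continuous_of_uniform_approx_of_continuous fun U hU => ?_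
      obtain ⟨ε, hε, hεU⟩ := Metric.mem_uniformity_dist.1 hU
      obtain ⟨y, hy, hxy⟩ := Metric.mem_closure_iff.1 hx ε hε
      refine ⟨fun t => expNegCLM hA hpos t y, hy, fun t => hεU ?_⟩
      rw [dist_eq_norm, ← map_sub]
      exact (norm_expNegCLM_le hA hpos t _).trans_lt (by rwa [← dist_eq_norm])

end

end Semigroup

/-! ### History segments and the forcing along a trajectory. -/

section Segment

variable {H : Type*} [NormedAddCommGroup H] {r : ℝ≥0} {u v : ℝ → H} {T t : ℝ}

theorem continuous_segment_aux (hu : ContinuousOn u (Icc (-(r : ℝ)) T)) (ht : t ∈ Icc 0 T) :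
    Continuous fun θ : Icc (-(r : ℝ)) 0 => u (t + θ) :=
  hu.comp_continuous (by fun_prop) fun θ =>
    ⟨by linarith [θ.2.1, ht.1], by linarith [θ.2.2, ht.2]⟩

theorem segment_apply (hu : ContinuousOn u (Icc (-(r : ℝ)) T)) (ht : t ∈ Icc 0 T)
    (θ : Icc (-(r : ℝ)) 0) : segment r u t θ = u (t + θ) := by
  rw [segment, dif_pos (continuous_segment_aux hu ht)]
  rfl

theorem segment_apply_of_continuous (hu : Continuous u) (t : ℝ) (θ : Icc (-(r : ℝ)) 0) :
    segment r u t θ = u (t + θ) := by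
  rw [segment, dif_pos (by fun_prop)]
  rfl

theorem segment_eq_of_forall {s : ℝ} (h : ∀ θ : Icc (-(r : ℝ)) 0, u (t + θ) = v (s + θ)) :
    segment r u t = segment r v s := by
  have he : (fun θ : Icc (-(r : ℝ)) 0 => u (t + θ)) = fun θ : Icc (-(r : ℝ)) 0 => v (s + θ) :=
    funext h
  by_cases hc : Continuous fun θ : Icc (-(r : ℝ)) 0 => u (t + θ)
  · rw [segment, segment, dif_pos hc, dif_pos (he ▸ hc)]
    exact ContinuousMap.ext h
  · rw [segment, segment, dif_neg hc, dif_neg (he ▸ hc)]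

theorem segment_congr (h : EqOn u v (Icc (-(r : ℝ)) T)) (ht : t ∈ Icc 0 T) :
    segment r u t = segment r v t :=
  segment_eq_of_forall fun θ => h ⟨by linarith [θ.2.1, ht.1], by linarith [θ.2.2, ht.2]⟩

theorem segment_shift (a : ℝ) : segment r (fun t => u (a + t)) t = segment r u (a + t) :=
  segment_eq_of_forall fun θ => by rw [add_assoc]

theorem continuous_segment (hu : Continuous u) : Continuous (segment r u) := by
  refine ContinuousMap.continuous_of_continuous_uncurry _ ?_
  have : (Function.uncurry fun (t : ℝ) (θ : Icc (-(r : ℝ)) 0) => segment r u t θ)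
      = fun p : ℝ × Icc (-(r : ℝ)) 0 => u (p.1 + p.2) :=
    funext fun p => segment_apply_of_continuous hu p.1 p.2
  rw [this]
  fun_prop

theorem atZero_segment (hu : ContinuousOn u (Icc (-(r : ℝ)) T)) (ht : t ∈ Icc 0 T) :
    atZero (segment r u t) = u t := by
  rw [atZero, segment_apply hu ht]
  simp

/-- Passing to a representative continuous on all of `ℝ`, constant beyond the end points, avoids
domain conditions in later integrals. -/
theorem exists_continuous_eqOn (hT : 0 ≤ T) (hu : ContinuousOn u (Icc (-(r : ℝ)) T)) :
    ∃ v : ℝ → H, Continuous v ∧ EqOn v u (Icc (-(r : ℝ)) T) := by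
  have h : -(r : ℝ) ≤ T := by linarith [r.2, show (0 : ℝ) ≤ r from r.2]
  exact ⟨IccExtend h ((Icc (-(r : ℝ)) T).domRestrict u), hu.domRestrict.Icc_extend',
    fun x hx => IccExtend_of_mem h _ hx⟩

variable {B : H → H} {η : Hist r H → Icc (0 : ℝ) r}

theorem continuous_delayTerm (hB : Continuous B) (hη : Continuous η) :
    Continuous (delayTerm B η) := by
  refine hB.comp ?_
  have : Continuous fun p : Hist r H × Icc (-(r : ℝ)) 0 => p.1 p.2 := continuous_eval
  exact this.comp (continuous_id.prodMk (Continuous.subtype_mk (by fun_prop) _))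

theorem delayTerm_segment (hu : ContinuousOn u (Icc (-(r : ℝ)) T)) (ht : t ∈ Icc 0 T) :
    delayTerm B η (segment r u t) = B (u (t - η (segment r u t))) := by
  rw [delayTerm, segment_apply hu ht, sub_eq_add_neg]

variable [InnerProductSpace ℝ H]

/-- The inhomogeneity `s ↦ F(u_s) - d u(s)` along `u`. -/
def forcing (d : ℝ) (B : H → H) (η : Hist r H → Icc (0 : ℝ) r) (u : ℝ → H) (s : ℝ) : H :=
  delayTerm B η (segment r u s) - d • u s

theorem continuous_forcing {d : ℝ} (hB : Continuous B) (hη : Continuous η) (hu : Continuous u) :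
    Continuous (forcing d B η u) :=
  ((continuous_delayTerm hB hη).comp (continuous_segment hu)).sub (hu.const_smul d)

theorem forcing_congr {d : ℝ} (h : EqOn u v (Icc (-(r : ℝ)) T)) (ht : t ∈ Icc 0 T) :
    forcing d B η u t = forcing d B η v t := by
  have hr : (0 : ℝ) ≤ r := r.2
  rw [forcing, forcing, segment_congr h ht, h ⟨by linarith [ht.1], ht.2⟩]

theorem forcing_shift {d : ℝ} (a : ℝ) :
    forcing d B η (fun t => u (a + t)) t = forcing d B η u (a + t) := by
  rw [forcing, forcing, segment_shift]

end Segment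

/-! ### The Duhamel convolution. -/

section Duhamel

variable {H : Type*} [NormedAddCommGroup H] [InnerProductSpace ℝ H]

/-- The convolution `∫₀ᵗ E(t-s) g(s) ds`. -/
def duhamel (E : ℝ → H →L[ℝ] H) (g : ℝ → H) (t : ℝ) : H :=
  ∫ s in (0 : ℝ)..t, E (t - s) (g s)

variable {E : ℝ → H →L[ℝ] H} {g g' : ℝ → H} {t : ℝ}

/-- Leaving out the end point matters when a solution is known only on `[-r,b)` and the integral is
taken up to `b`. -/
theorem duhamel_congr (ht : 0 ≤ t) (h : ∀ s ∈ Ico 0 t, g s = g' s) :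
    duhamel E g t = duhamel E g' t := by
  rw [duhamel, duhamel, intervalIntegral.integral_of_le ht, intervalIntegral.integral_of_le ht,
    integral_Ioc_eq_integral_Ioo, integral_Ioc_eq_integral_Ioo]
  exact setIntegral_congr_fun measurableSet_Ioo fun s hs => by
    simp only [h s ⟨hs.1.le, hs.2⟩]

theorem IsContractionSemigroup.continuous_comp (hE : IsContractionSemigroup E) {X : Type*}
    [TopologicalSpace X] {f : X → ℝ} {h : X → H} (hf : Continuous f) (hh : Continuous h) :
    Continuous fun x => E (f x) (h x) :=
  hE.continuous_uncurry.comp (hf.prodMk hh)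

theorem continuous_duhamel (hE : IsContractionSemigroup E) (hg : Continuous g) :
    Continuous (duhamel E g) := by
  refine intervalIntegral.continuous_parametric_intervalIntegral_of_continuous
    (f := fun t s => E (t - s) (g s)) ?_ continuous_id
  exact hE.continuous_comp (by fun_prop) (by fun_prop)

theorem duhamel_sub (hE : IsContractionSemigroup E) (hg : Continuous g) (hg' : Continuous g') :
    duhamel E g t - duhamel E g' t = duhamel E (fun s => g s - g' s) t := by
  simp only [duhamel, map_sub]
  rw [intervalIntegral.integral_sub]
  · exact (hE.continuous_comp (by fun_prop) hg).intervalIntegrable _ _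
  · exact (hE.continuous_comp (by fun_prop) hg').intervalIntegrable _ _

theorem norm_duhamel_le (hE : IsContractionSemigroup E) {f : ℝ → ℝ} (hf : Continuous f)
    (ht : 0 ≤ t) (h : ∀ s ∈ Icc 0 t, ‖g s‖ ≤ f s) :
    ‖duhamel E g t‖ ≤ ∫ s in (0 : ℝ)..t, f s := by
  refine intervalIntegral.norm_integral_le_of_norm_le ht
    (ae_of_all _ fun s hs => (hE.norm_le _ _).trans (h s ⟨hs.1.le, hs.2⟩))
    (hf.intervalIntegrable _ _)

/-- Split the integral at `a`; on the first piece `E (a + t - s) = E t ∘ E (a - s)`. This underlies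
translation and concatenation of solutions. -/
theorem duhamel_add [CompleteSpace H] (hE : IsContractionSemigroup E) (hg : Continuous g) {a : ℝ}
    (ha : 0 ≤ a) (ht : 0 ≤ t) :
    duhamel E g (a + t) = E t (duhamel E g a) + duhamel E (fun s => g (a + s)) t := by
  have hc : ∀ c, Continuous fun s => E (c - s) (g s) := fun c =>
    hE.continuous_comp (by fun_prop) hg
  have hi : ∀ c x y, IntervalIntegrable (fun s => E (c - s) (g s)) volume x y := fun c x y =>
    (hc c).intervalIntegrable _ _
  rw [duhamel, ← intervalIntegral.integral_add_adjacent_intervals (hi (a + t) 0 a)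
    (hi (a + t) a (a + t))]
  congr 1
  · rw [duhamel, ← ContinuousLinearMap.intervalIntegral_comp_comm _ (hi a 0 a)]
    refine intervalIntegral.integral_congr fun s hs => ?_
    rw [uIcc_of_le ha] at hs
    have : a + t - s = t + (a - s) := by ring
    simp only [this, hE.add t (a - s) ht (by linarith [hs.2])]
  · have := intervalIntegral.integral_comp_add_left (a := 0) (b := t)
      (fun s => E (a + t - s) (g s)) a
    rw [add_zero] at this
    rw [duhamel, ← this]
    simp only [add_sub_add_left_eq_sub]

end Duhamel

/-! ### Translation and concatenation of mild solutions. -/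

section Mild

variable {H : Type*} [NormedAddCommGroup H] [InnerProductSpace ℝ H] [CompleteSpace H] {r : ℝ≥0}
  {A : H →ₗ.[ℝ] H} {E : ℝ → H →L[ℝ] H} {d : ℝ} {B : H → H} {η : Hist r H → Icc (0 : ℝ) r}
  {φ : Hist r H} {T a b : ℝ} {u v w : ℝ → H}

theorem isMildSolutionOn_iff (hAE : ∀ t, 0 ≤ t → ∀ x, expNeg A t x = E t x) :
    IsMildSolutionOn A d B η φ T u ↔ ContinuousOn u (Icc (-(r : ℝ)) T) ∧
      (∀ θ : Icc (-(r : ℝ)) 0, u θ = φ θ) ∧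
      ∀ t ∈ Icc 0 T, u t = E t (atZero φ) + duhamel E (forcing d B η u) t := by
  have key : ∀ t ∈ Icc 0 T, expNeg A t (atZero φ) +
      ∫ s in (0 : ℝ)..t, expNeg A (t - s) (delayTerm B η (segment r u s) - d • u s) =
      E t (atZero φ) + duhamel E (forcing d B η u) t := by
    intro t ht
    rw [hAE t ht.1, duhamel]
    congr 1
    refine intervalIntegral.integral_congr fun s hs => ?_
    rw [uIcc_of_le ht.1] at hs
    exact hAE _ (by linarith [hs.2]) _
  constructor
  · rintro ⟨h1, h2, h3⟩
    exact ⟨h1, h2, fun t ht => (h3 t ht).trans (key t ht)⟩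
  · rintro ⟨h1, h2, h3⟩
    exact ⟨h1, h2, fun t ht => (h3 t ht).trans (key t ht).symm⟩

theorem IsMildSolutionOn.mono (hu : IsMildSolutionOn A d B η φ T u) (h : a ≤ T) :
    IsMildSolutionOn A d B η φ a u :=
  ⟨hu.1.mono (Icc_subset_Icc_right h), hu.2, fun t ht => hu.3 t ⟨ht.1, ht.2.trans h⟩⟩

theorem IsMildSolutionOn.congr (hu : IsMildSolutionOn A d B η φ T u) (hT : 0 ≤ T)
    (h : EqOn v u (Icc (-(r : ℝ)) T)) : IsMildSolutionOn A d B η φ T v := by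
  have hr : (0 : ℝ) ≤ r := r.2
  refine ⟨hu.1.congr h, fun θ => ?_, fun t ht => ?_⟩
  · rw [h ⟨θ.2.1, θ.2.2.trans hT⟩, hu.2]
  · rw [h ⟨by linarith [ht.1], ht.2⟩, hu.3 t ht]
    congr 1
    refine intervalIntegral.integral_congr fun s hs => ?_
    rw [uIcc_of_le ht.1] at hs
    have hs' : s ∈ Icc 0 T := ⟨hs.1, hs.2.trans ht.2⟩
    rw [segment_congr h hs', h ⟨by linarith [hs.1], hs'.2⟩]

theorem IsMildSolutionOn.exists_continuous (hu : IsMildSolutionOn A d B η φ T u) (hT : 0 ≤ T) :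
    ∃ v, Continuous v ∧ EqOn v u (Icc (-(r : ℝ)) T) ∧ IsMildSolutionOn A d B η φ T v := by
  obtain ⟨v, hv, he⟩ := exists_continuous_eqOn hT hu.1
  exact ⟨v, hv, he, hu.congr hT he⟩

theorem IsMildSolutionOn.segment_zero (hu : IsMildSolutionOn A d B η φ T u) (hT : 0 ≤ T) :
    segment r u 0 = φ := by
  ext θ
  rw [segment_apply hu.1 ⟨le_rfl, hT⟩, zero_add, hu.2]

section

variable (hE : IsContractionSemigroup E) (hAE : ∀ t, 0 ≤ t → ∀ x, expNeg A t x = E t x)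
  (hB : Continuous B) (hη : Continuous η)
include hE hAE hB hη

theorem isMildSolutionOn_add_iff_of_continuous (hu : Continuous u) (ha : 0 ≤ a) (hb : 0 ≤ b) :
    IsMildSolutionOn A d B η φ (a + b) u ↔ IsMildSolutionOn A d B η φ a u ∧
      IsMildSolutionOn A d B η (segment r u a) b (fun t => u (a + t)) := by
  have hseg : atZero (segment r u a) = u a := atZero_segment hu.continuousOn ⟨ha, le_rfl⟩
  have hg := continuous_forcing (d := d) hB hη hu
  have hf : forcing d B η (fun t => u (a + t)) = fun s => forcing d B η u (a + s) :=
    funext fun s => forcing_shift a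
  have key : ∀ t, 0 ≤ t → u a = E a (atZero φ) + duhamel E (forcing d B η u) a →
      (u (a + t) = E t (atZero (segment r u a)) +
        duhamel E (forcing d B η fun t => u (a + t)) t ↔
      u (a + t) = E (a + t) (atZero φ) + duhamel E (forcing d B η u) (a + t)) := by
    intro t ht h
    rw [hseg, hf, duhamel_add hE hg ha ht, h, add_comm a t, hE.add t a ht ha, map_add, add_assoc]
  simp only [isMildSolutionOn_iff hAE]
  constructor
  · rintro ⟨h1, h2, h3⟩
    have ha' := h3 a ⟨ha, by linarith⟩
    refine ⟨⟨hu.continuousOn, h2, fun t ht => h3 t ⟨ht.1, by linarith [ht.2]⟩⟩,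
      (hu.comp (by fun_prop)).continuousOn,
      fun θ => (segment_apply_of_continuous hu a θ).symm, fun t ht => ?_⟩
    exact (key t ht.1 ha').2 (h3 _ ⟨by linarith [ht.1], by linarith [ht.2]⟩)
  · rintro ⟨⟨h1, h2, h3⟩, h4, h5, h6⟩
    refine ⟨hu.continuousOn, h2, fun t ht => ?_⟩
    rcases le_total t a with hta | hta
    · exact h3 t ⟨ht.1, hta⟩
    · have := (key (t - a) (by linarith) (h3 a ⟨ha, le_rfl⟩)).1
        (h6 _ ⟨by linarith, by linarith [ht.2]⟩)
      rwa [add_sub_cancel] at this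

/-- Time translates of mild solutions are mild solutions. -/
theorem IsMildSolutionOn.shift (hu : IsMildSolutionOn A d B η φ (a + b) u) (ha : 0 ≤ a)
    (hb : 0 ≤ b) :
    IsMildSolutionOn A d B η (segment r u a) b (fun t => u (a + t)) := by
  obtain ⟨v, hv, he, hm⟩ := hu.exists_continuous (add_nonneg ha hb)
  have := ((isMildSolutionOn_add_iff_of_continuous hE hAE hB hη hv ha hb).1 hm).2
  rw [segment_congr he ⟨ha, by linarith⟩] at this
  exact this.congr hb fun t ht => (he ⟨by linarith [ht.1], by linarith [ht.2]⟩).symm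

/-- Concatenation of mild solutions. -/
theorem IsMildSolutionOn.exists_concat (hu : IsMildSolutionOn A d B η φ a u)
    (hw : IsMildSolutionOn A d B η (segment r u a) b w) (ha : 0 ≤ a) (hb : 0 ≤ b) :
    ∃ v, IsMildSolutionOn A d B η φ (a + b) v := by
  have hr : (0 : ℝ) ≤ r := r.2
  obtain ⟨u', hu', heu, hmu⟩ := hu.exists_continuous ha
  obtain ⟨w', hw', hew, hmw⟩ := hw.exists_continuous hb
  have hseg := segment_congr heu ⟨ha, le_rfl⟩
  rw [← hseg] at hmw
  have hw0 : ∀ s ∈ Icc (-(r : ℝ)) 0, w' s = u' (a + s) := fun s hs => by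
    rw [hmw.2 ⟨s, hs⟩, segment_apply_of_continuous hu']
  -- Since `w' 0 = u' a`, this is `u'` before `a` and the translate of `w'` after it, and it is
  -- visibly continuous.
  set v : ℝ → H := fun t => u' (min t a) + w' (max (t - a) 0) - u' a with hv
  have hvc : Continuous v := by rw [hv]; fun_prop
  have hw00 : w' 0 = u' a := by simpa using hw0 0 ⟨by linarith, le_rfl⟩
  have hv1 : ∀ t, t ≤ a → v t = u' t := fun t ht => by
    simp only [hv]
    rw [min_eq_left ht, max_eq_right (by linarith), hw00, add_sub_cancel_right]
  have hv2 : ∀ t, -(r : ℝ) ≤ t → v (a + t) = w' t := fun t ht => by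
    rcases le_total t 0 with h | h
    · rw [hv1 _ (by linarith), hw0 t ⟨ht, h⟩]
    · simp only [hv]
      rw [min_eq_right (by linarith), add_sub_cancel_left, add_sub_cancel_left, max_eq_left h]
  have he1 : EqOn v u' (Icc (-(r : ℝ)) a) := fun t ht => hv1 t ht.2
  refine ⟨v, (isMildSolutionOn_add_iff_of_continuous hE hAE hB hη hvc ha hb).2
    ⟨hmu.congr ha he1, ?_⟩⟩
  rw [segment_congr he1 ⟨ha, le_rfl⟩]
  exact hmw.congr hb fun t ht => hv2 t ht.1

end

end Mild

/-! ### Freezing the delay for a short time. -/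

section Freeze

variable {H : Type*} [NormedAddCommGroup H] {r : ℝ≥0}

theorem neg_coe_nonpos (r : ℝ≥0) : -(r : ℝ) ≤ 0 := neg_nonpos.2 r.2

/-- The history at time `t` of the extension of `ψ` by the constant `ψ(0)`. -/
def freeze (ψ : Hist r H) (t : ℝ) : Hist r H :=
  ⟨fun θ => ψ (projIcc (-(r : ℝ)) 0 (neg_coe_nonpos r) (t + θ)),
    ψ.continuous.comp (continuous_projIcc.comp (by fun_prop))⟩

theorem freeze_apply (ψ : Hist r H) (t : ℝ) (θ : Icc (-(r : ℝ)) 0) :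
    freeze ψ t θ = ψ (projIcc (-(r : ℝ)) 0 (neg_coe_nonpos r) (t + θ)) := rfl

theorem freeze_zero (ψ : Hist r H) : freeze ψ 0 = ψ := by
  ext θ
  rw [freeze_apply, zero_add, projIcc_val]

theorem continuous_freeze : Continuous fun p : Hist r H × ℝ => freeze p.1 p.2 := by
  refine ContinuousMap.continuous_of_continuous_uncurry _ ?_
  have h : Continuous fun q : Hist r H × Icc (-(r : ℝ)) 0 => q.1 q.2 := continuous_eval
  refine h.comp (f := fun p : (Hist r H × ℝ) × Icc (-(r : ℝ)) 0 =>
    (p.1.1, projIcc (-(r : ℝ)) 0 (neg_coe_nonpos r) (p.1.2 + p.2))) ?_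
  exact (by fun_prop : Continuous fun p : (Hist r H × ℝ) × Icc (-(r : ℝ)) 0 => p.1.1).prodMk
    (continuous_projIcc.comp (by fun_prop))

/-- During `[0,δ]`, the delay along a trajectory starting at `ψ` is determined by `ψ`. -/
def LocallyFrozen (η : Hist r H → Icc (0 : ℝ) r) (ψ : Hist r H) (δ : ℝ) : Prop :=
  ∀ t ∈ Icc 0 δ, ∀ χ : Hist r H,
    (∀ θ : Icc (-(r : ℝ)) 0, (θ : ℝ) ≤ -t → χ θ = freeze ψ t θ) → η χ = η (freeze ψ t)

theorem LocallyFrozen.mono {η : Hist r H → Icc (0 : ℝ) r} {ψ : Hist r H} {δ δ' : ℝ}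
    (h : LocallyFrozen η ψ δ) (h' : δ' ≤ δ) : LocallyFrozen η ψ δ' :=
  fun t ht => h t ⟨ht.1, ht.2.trans h'⟩

theorem IgnoresOutside.exists_eventually_locallyFrozen {η Θu Θl : Hist r H → Icc (0 : ℝ) r}
    (h : IgnoresOutside η Θu Θl) (hΘ : Continuous Θl) (hpos : ∀ φ, (0 : ℝ) < Θl φ)
    (ψ₀ : Hist r H) {ε : ℝ} (hε : 0 < ε) :
    ∃ δ, 0 < δ ∧ δ ≤ ε ∧ ∀ᶠ ψ in 𝓝 ψ₀, LocallyFrozen η ψ δ := by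
  have hc : Continuous fun p : Hist r H × ℝ => (Θl (freeze p.1 p.2) : ℝ) :=
    continuous_subtype_val.comp (hΘ.comp continuous_freeze)
  -- Once `t ≤ Θl ψ₀ / 2`, this bound makes every `θ ≤ -Θl (freeze ψ t)` satisfy `θ ≤ -t`. The
  -- ignoring condition, with `freeze ψ t` as reference, then sees only values prescribed by `ψ`.
  have hev : ∀ᶠ p : Hist r H × ℝ in 𝓝 (ψ₀, 0), (Θl ψ₀ : ℝ) / 2 < Θl (freeze p.1 p.2) := by
    refine (hc.tendsto (ψ₀, 0)).eventually_const_lt ?_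
    simp only [freeze_zero]
    exact half_lt_self (hpos ψ₀)
  rw [nhds_prod_eq, eventually_prod_iff] at hev
  obtain ⟨P, hP, Q, hQ, hPQ⟩ := hev
  obtain ⟨ρ, hρ, hQρ⟩ := Metric.eventually_nhds_iff.1 hQ
  refine ⟨min ε (min (ρ / 2) (Θl ψ₀ / 2)),
    lt_min hε (lt_min (half_pos hρ) (half_pos (hpos ψ₀))), min_le_left _ _, ?_⟩
  filter_upwards [hP] with ψ hψ t ht χ hχ
  have h1 : t ≤ ρ / 2 := ht.2.trans ((min_le_right _ _).trans (min_le_left _ _))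
  have h2 : t ≤ Θl ψ₀ / 2 := ht.2.trans ((min_le_right _ _).trans (min_le_right _ _))
  have hQt : Q t := hQρ (by rw [Real.dist_eq, sub_zero, abs_of_nonneg ht.1]; linarith)
  have h3 := hPQ hψ hQt
  refine h (freeze ψ t) χ fun θ hθ => hχ θ ?_
  have := hθ.2
  simp only at h3
  linarith

end Freeze

/-! ### Local existence and short-time estimates. -/

section Local

variable {H : Type*} [NormedAddCommGroup H] {r : ℝ≥0}
  {η : Hist r H → Icc (0 : ℝ) r} {φ ψ : Hist r H} {T δ s : ℝ} {u v : ℝ → H}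

/-- For `θ ≤ -s` both segments read the initial history at `s + θ ≤ 0`. -/
theorem LocallyFrozen.apply_segment (h : LocallyFrozen η ψ δ)
    (hu : ContinuousOn u (Icc (-(r : ℝ)) T)) (hi : ∀ θ : Icc (-(r : ℝ)) 0, u θ = ψ θ)
    (hT : T ≤ δ) (hs : s ∈ Icc 0 T) : η (segment r u s) = η (freeze ψ s) := by
  refine h s ⟨hs.1, hs.2.trans hT⟩ _ fun θ hθ => ?_
  have hmem : s + θ ∈ Icc (-(r : ℝ)) 0 := ⟨by linarith [θ.2.1, hs.1], by linarith⟩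
  rw [segment_apply hu hs, freeze_apply, projIcc_of_mem _ hmem, ← hi]

/-- The continuous function which is `ψ` on `[-r,0]` and `v` on `[0,δ]` if `v(0) = ψ(0)`. -/
def glue (hδ : 0 ≤ δ) (ψ : Hist r H) (v : C(Icc 0 δ, H)) (s : ℝ) : H :=
  ψ (projIcc (-(r : ℝ)) 0 (neg_coe_nonpos r) s) + v (projIcc 0 δ hδ s) - atZero ψ

theorem continuous_glue (hδ : 0 ≤ δ) (ψ : Hist r H) (v : C(Icc 0 δ, H)) :
    Continuous (glue hδ ψ v) :=
  ((ψ.continuous.comp continuous_projIcc).add (v.continuous.comp continuous_projIcc)).sub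
    continuous_const

theorem norm_glue_sub_le (hδ : 0 ≤ δ) (ψ : Hist r H) (v w : C(Icc 0 δ, H)) (s : ℝ) :
    ‖glue hδ ψ v s - glue hδ ψ w s‖ ≤ ‖v - w‖ := by
  simp only [glue]
  rw [sub_sub_sub_cancel_right, add_sub_add_left_eq_sub]
  exact (v - w).norm_coe_le_norm _

theorem glue_of_nonneg (hδ : 0 ≤ δ) (ψ : Hist r H) (v : C(Icc 0 δ, H)) (hs : s ∈ Icc 0 δ) :
    glue hδ ψ v s = v ⟨s, hs⟩ := by
  rw [glue, projIcc_of_right_le _ hs.1, projIcc_of_mem _ hs, atZero, add_sub_cancel_left]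

theorem glue_of_nonpos (hδ : 0 ≤ δ) (ψ : Hist r H) (v : C(Icc 0 δ, H))
    (hv : v ⟨0, le_rfl, hδ⟩ = atZero ψ) (θ : Icc (-(r : ℝ)) 0) : glue hδ ψ v θ = ψ θ := by
  rw [glue, projIcc_val, projIcc_of_le_left _ θ.2.2, hv, add_sub_cancel_right]

variable [InnerProductSpace ℝ H] [CompleteSpace H] {A : H →ₗ.[ℝ] H}
  {E : ℝ → H →L[ℝ] H} {d : ℝ} {B : H → H} {L : ℝ≥0}
  (hE : IsContractionSemigroup E) (hAE : ∀ t, 0 ≤ t → ∀ x, expNeg A t x = E t x)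
  (hB : LipschitzWith L B) (hd : 0 ≤ d)
include hE hAE hB hd

/-- An a priori bound for mild solutions on short intervals. -/
theorem IsMildSolutionOn.norm_le (hu : IsMildSolutionOn A d B η φ T u) (hT : 0 ≤ T)
    (hTL : T * (L + d) ≤ 1 / 2) :
    ∀ t ∈ Icc (-(r : ℝ)) T, ‖u t‖ ≤ 2 * (‖φ‖ + T * ‖B 0‖) := by
  have hr := neg_coe_nonpos r
  -- In place of Gronwall: at a maximum point the integral contributes at most `D / 2`, which is
  -- absorbed on the left; this produces the factor `2`.
  obtain ⟨t₀, ht₀, hmax⟩ := isCompact_Icc.exists_isMaxOn (s := Icc (-(r : ℝ)) T)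
    ⟨0, hr, hT⟩ (f := fun t => ‖u t‖) hu.1.norm
  set D := ‖u t₀‖ with hD
  have hmax' : ∀ t ∈ Icc (-(r : ℝ)) T, ‖u t‖ ≤ D := fun t ht => hmax ht
  suffices hDle : D ≤ 2 * (‖φ‖ + T * ‖B 0‖) from fun t ht => (hmax' t ht).trans hDle
  have hB0 := mul_nonneg hT (norm_nonneg (B 0))
  have hφ0 := norm_nonneg φ
  rcases le_total t₀ 0 with h0 | h0
  · have : D ≤ ‖φ‖ := by
      rw [hD, hu.2 ⟨t₀, ht₀.1, h0⟩]
      exact φ.norm_coe_le_norm _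
    linarith
  · have hf : ∀ s ∈ Icc 0 t₀, ‖forcing d B η u s‖ ≤ ‖B 0‖ + (L + d) * D := by
      intro s hs
      have hs' : s ∈ Icc 0 T := ⟨hs.1, hs.2.trans ht₀.2⟩
      rw [forcing, delayTerm_segment hu.1 hs']
      have hη' := (η (segment r u s)).2
      have h1 := hB.norm_sub_le (u (s - η (segment r u s))) 0
      have h2 := hmax' (s - η (segment r u s))
        ⟨by linarith [hη'.2, hs.1], by linarith [hη'.1, hs'.2]⟩
      have h3 := hmax' s ⟨by linarith [hs.1], hs'.2⟩
      have h4 := norm_le_norm_add_norm_sub' (B (u (s - η (segment r u s)))) (B 0)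
      rw [sub_zero] at h1
      refine (norm_sub_le _ _).trans ?_
      rw [norm_smul, Real.norm_of_nonneg hd]
      have h5 := mul_le_mul_of_nonneg_left h2 L.2
      have h6 := mul_le_mul_of_nonneg_left h3 hd
      simp only [NNReal.val_eq_coe] at h5
      linarith
    have hu3 := ((isMildSolutionOn_iff hAE).1 hu).2.2 t₀ ⟨h0, ht₀.2⟩
    have h1 : ‖E t₀ (atZero φ)‖ ≤ ‖φ‖ := (hE.norm_le _ _).trans (φ.norm_coe_le_norm _)
    have h2 : D ≤ ‖φ‖ + ∫ s in (0 : ℝ)..t₀, (‖B 0‖ + (L + d) * D) := by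
      rw [hD, hu3]
      refine (norm_add_le _ _).trans (add_le_add h1 ?_)
      rw [← hu3]
      exact norm_duhamel_le hE continuous_const h0 hf
    rw [intervalIntegral.integral_const, sub_zero, smul_eq_mul, mul_add, ← mul_assoc] at h2
    have h3 : t₀ * (L + d) ≤ 1 / 2 :=
      (mul_le_mul_of_nonneg_right ht₀.2 (add_nonneg L.2 hd)).trans hTL
    have h4 := mul_le_mul_of_nonneg_right h3 (norm_nonneg (u t₀))
    have h5 := mul_le_mul_of_nonneg_right ht₀.2 (norm_nonneg (B 0))
    rw [← hD] at h4
    linarith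

variable (hη : Continuous η)
include hη

theorem LocallyFrozen.exists_isMildSolutionOn (h : LocallyFrozen η ψ δ) (hδ : 0 ≤ δ)
    (hδL : δ * (L + d) ≤ 1 / 2) : ∃ u, IsMildSolutionOn A d B η ψ δ u := by
  have hτ : Continuous fun s : ℝ => (η (freeze ψ s) : ℝ) :=
    continuous_subtype_val.comp
      (hη.comp (continuous_freeze.comp (continuous_const.prodMk continuous_id)))
  -- The delay is prescribed by `ψ` and does not depend on `v`, so `G` is Lipschitz in `v`. It is
  -- identified with the true delay only for the fixed point.
  set G : C(Icc 0 δ, H) → ℝ → H := fun v s =>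
    B (glue hδ ψ v (s - η (freeze ψ s))) - d • glue hδ ψ v s with hG
  have hGc : ∀ v, Continuous (G v) := fun v =>
    (hB.continuous.comp ((continuous_glue hδ ψ v).comp (continuous_id.sub hτ))).sub
      ((continuous_glue hδ ψ v).const_smul d)
  have hGd : ∀ v w s, ‖G v s - G w s‖ ≤ (L + d) * ‖v - w‖ := fun v w s => by
    have h1 := hB.norm_sub_le (glue hδ ψ v (s - η (freeze ψ s)))
      (glue hδ ψ w (s - η (freeze ψ s)))
    have h2 := norm_glue_sub_le hδ ψ v w (s - η (freeze ψ s))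
    have h3 := norm_glue_sub_le hδ ψ v w s
    have h4 : G v s - G w s = (B (glue hδ ψ v (s - η (freeze ψ s))) -
        B (glue hδ ψ w (s - η (freeze ψ s)))) - d • (glue hδ ψ v s - glue hδ ψ w s) := by
      simp only [hG, smul_sub]; abel
    rw [h4]
    refine (norm_sub_le _ _).trans ?_
    rw [norm_smul, Real.norm_of_nonneg hd, add_mul]
    exact add_le_add (h1.trans (mul_le_mul_of_nonneg_left h2 L.2))
      (mul_le_mul_of_nonneg_left h3 hd)
  -- No constraint `v(0) = ψ(0)` is imposed: `glue` is continuous for every `v`, and a fixed point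
  -- satisfies the constraint automatically.
  let Φ : C(Icc 0 δ, H) → C(Icc 0 δ, H) := fun v =>
    ⟨fun t => E t (atZero ψ) + duhamel E (G v) t,
      ((hE.continuous (atZero ψ)).comp continuous_subtype_val).add
        ((continuous_duhamel hE (hGc v)).comp continuous_subtype_val)⟩
  have hΦ : ContractingWith (1 / 2) Φ := by
    refine ⟨by norm_num, LipschitzWith.of_dist_le_mul fun v w => ?_⟩
    rw [ContinuousMap.dist_le (by positivity)]
    intro t
    change dist (E t (atZero ψ) + duhamel E (G v) t) (E t (atZero ψ) + duhamel E (G w) t) ≤ _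
    rw [dist_eq_norm, add_sub_add_left_eq_sub, duhamel_sub hE (hGc v) (hGc w)]
    refine (norm_duhamel_le hE (f := fun _ => (L + d) * ‖v - w‖) continuous_const t.2.1
      fun s _ => hGd v w s).trans ?_
    rw [intervalIntegral.integral_const, sub_zero, smul_eq_mul, dist_eq_norm, ← mul_assoc]
    refine mul_le_mul_of_nonneg_right ?_ (norm_nonneg _)
    have : (t : ℝ) * (L + d) ≤ δ * (L + d) :=
      mul_le_mul_of_nonneg_right t.2.2 (add_nonneg L.2 hd)
    push_cast
    linarith
  obtain ⟨v, hv, -⟩ := hΦ.exists_fixedPoint 0 (edist_ne_top _ _)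
  have hv' : ∀ t : Icc 0 δ, v t = E t (atZero ψ) + duhamel E (G v) t := fun t =>
    (DFunLike.congr_fun hv t).symm
  have hv0 : v ⟨0, le_rfl, hδ⟩ = atZero ψ := by
    rw [hv']
    simp [duhamel, hE.zero]
  have hi := glue_of_nonpos hδ ψ v hv0
  have hc := continuous_glue hδ ψ v
  refine ⟨glue hδ ψ v, (isMildSolutionOn_iff hAE).2 ⟨hc.continuousOn, hi, fun t ht => ?_⟩⟩
  rw [glue_of_nonneg hδ ψ v ht, hv']
  congr 1
  refine duhamel_congr ht.1 fun s hs => ?_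
  have hs' : s ∈ Icc 0 δ := ⟨hs.1, hs.2.le.trans ht.2⟩
  rw [forcing, delayTerm_segment hc.continuousOn hs', h.apply_segment hc.continuousOn hi le_rfl hs']

/-- Continuous dependence of mild solutions on the initial history, for a short time. -/
theorem norm_sub_le_of_locallyFrozen (hφ : LocallyFrozen η φ δ) (hψ : LocallyFrozen η ψ δ)
    (hδL : δ * (L + d) ≤ 1 / 2) (hT : 0 ≤ T) (hTδ : T ≤ δ) (hu : IsMildSolutionOn A d B η φ T u)
    (huc : Continuous u) (hv : IsMildSolutionOn A d B η ψ T v) :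
    ∀ t ∈ Icc (-(r : ℝ)) T, ‖u t - v t‖ ≤ 2 * (‖φ - ψ‖ + L * ∫ s in (0 : ℝ)..T,
      ‖u (s - η (freeze φ s)) - u (s - η (freeze ψ s))‖) := by
  obtain ⟨w, hwc, hwv, hw⟩ := hv.exists_continuous hT
  have hr := neg_coe_nonpos r
  have hτ : ∀ χ : Hist r H, Continuous fun s : ℝ => (η (freeze χ s) : ℝ) := fun χ =>
    continuous_subtype_val.comp
      (hη.comp (continuous_freeze.comp (continuous_const.prodMk continuous_id)))
  -- The delay mismatch is kept as an error term along the single function `u`: it has no bound in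
  -- terms of `‖φ - ψ‖` when `η` is merely continuous.
  set e : ℝ → ℝ := fun s => ‖u (s - η (freeze φ s)) - u (s - η (freeze ψ s))‖ with he
  have hec : Continuous e := by
    have h1 := hτ φ
    have h2 := hτ ψ
    simp only [he]
    fun_prop
  have he0 : ∀ x y, x ≤ y → 0 ≤ ∫ s in x..y, e s := fun x y hxy =>
    intervalIntegral.integral_nonneg hxy fun s _ => norm_nonneg _
  obtain ⟨t₀, ht₀, hmax⟩ := isCompact_Icc.exists_isMaxOn (s := Icc (-(r : ℝ)) T)
    ⟨0, hr, hT⟩ (f := fun t => ‖u t - w t‖) (by fun_prop)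
  set D := ‖u t₀ - w t₀‖ with hD
  have hmax' : ∀ t ∈ Icc (-(r : ℝ)) T, ‖u t - w t‖ ≤ D := fun t ht => hmax ht
  suffices hDle : D ≤ 2 * (‖φ - ψ‖ + L * ∫ s in (0 : ℝ)..T, e s) by
    intro t ht
    rw [← hwv ht]
    exact (hmax' t ht).trans hDle
  have hI := mul_nonneg L.2 (he0 0 T hT)
  rcases le_total t₀ 0 with h0 | h0
  · have : D ≤ ‖φ - ψ‖ := by
      rw [hD, hu.2 ⟨t₀, ht₀.1, h0⟩, hw.2 ⟨t₀, ht₀.1, h0⟩]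
      exact (φ - ψ).norm_coe_le_norm _
    have h3 := norm_nonneg (φ - ψ)
    have hI' : 0 ≤ (L : ℝ) * ∫ s in (0 : ℝ)..T, e s := hI
    linarith
  · have hf : ∀ s ∈ Icc 0 t₀, ‖forcing d B η u s - forcing d B η w s‖ ≤ L * e s + (L + d) * D := by
      intro s hs
      have hs' : s ∈ Icc 0 T := ⟨hs.1, hs.2.trans ht₀.2⟩
      rw [forcing, forcing, delayTerm_segment hu.1 hs', delayTerm_segment hw.1 hs',
        hφ.apply_segment hu.1 hu.2 hTδ hs', hψ.apply_segment hw.1 hw.2 hTδ hs']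
      have hη' := (η (freeze ψ s)).2
      have h1 := hB.norm_sub_le (u (s - η (freeze φ s))) (w (s - η (freeze ψ s)))
      have h2 := hmax' (s - η (freeze ψ s))
        ⟨by linarith [hη'.2, hs.1], by linarith [hη'.1, hs'.2]⟩
      have h3 := hmax' s ⟨by linarith [hs.1], hs'.2⟩
      have h4 := norm_sub_le_norm_sub_add_norm_sub (u (s - η (freeze φ s)))
        (u (s - η (freeze ψ s))) (w (s - η (freeze ψ s)))
      rw [sub_sub_sub_comm, ← smul_sub]
      refine (norm_sub_le _ _).trans ?_
      rw [norm_smul, Real.norm_of_nonneg hd]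
      have h5 : (L : ℝ) * ‖u (s - η (freeze φ s)) - w (s - η (freeze ψ s))‖ ≤ L * (e s + D) :=
        mul_le_mul_of_nonneg_left (h4.trans (by simp only [he]; linarith)) L.2
      have h6 := mul_le_mul_of_nonneg_left h3 hd
      linarith
    have hu3 := ((isMildSolutionOn_iff hAE).1 hu).2.2 t₀ ⟨h0, ht₀.2⟩
    have hw3 := ((isMildSolutionOn_iff hAE).1 hw).2.2 t₀ ⟨h0, ht₀.2⟩
    have h1 : ‖E t₀ (atZero φ) - E t₀ (atZero ψ)‖ ≤ ‖φ - ψ‖ := by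
      rw [← map_sub]
      exact (hE.norm_le _ _).trans ((φ - ψ).norm_coe_le_norm _)
    have hdiff : u t₀ - w t₀ = E t₀ (atZero φ) - E t₀ (atZero ψ) +
        duhamel E (fun s => forcing d B η u s - forcing d B η w s) t₀ := by
      rw [hu3, hw3, add_sub_add_comm, duhamel_sub hE (continuous_forcing hB.continuous hη huc)
        (continuous_forcing hB.continuous hη hwc)]
    have h2 : D ≤ ‖φ - ψ‖ + ∫ s in (0 : ℝ)..t₀, (L * e s + (L + d) * D) :=
      ((congrArg norm hdiff).le.trans (norm_add_le _ _)).trans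
        (add_le_add h1 (norm_duhamel_le hE (by fun_prop) h0 hf))
    rw [intervalIntegral.integral_add ((hec.const_mul _).intervalIntegrable _ _)
      (intervalIntegrable_const), intervalIntegral.integral_const_mul,
      intervalIntegral.integral_const, sub_zero, smul_eq_mul, ← mul_assoc] at h2
    have h3 : t₀ * (L + d) ≤ 1 / 2 :=
      (mul_le_mul_of_nonneg_right (ht₀.2.trans hTδ) (add_nonneg L.2 hd)).trans hδL
    have h4 := mul_le_mul_of_nonneg_right h3 (norm_nonneg (u t₀ - w t₀))
    have h5 : ∫ s in (0 : ℝ)..t₀, e s ≤ ∫ s in (0 : ℝ)..T, e s := by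
      rw [← intervalIntegral.integral_add_adjacent_intervals (hec.intervalIntegrable 0 t₀)
        (hec.intervalIntegrable t₀ T)]
      linarith [he0 t₀ T ht₀.2]
    have h6 : (L : ℝ) * ∫ s in (0 : ℝ)..t₀, e s ≤ L * ∫ s in (0 : ℝ)..T, e s :=
      mul_le_mul_of_nonneg_left h5 L.2
    rw [← hD] at h4
    linarith

end Local

/-! ### Duhamel integrals of bounded measurable forcing. -/

section BoundedDuhamel

variable {H : Type*} [NormedAddCommGroup H] [InnerProductSpace ℝ H] {E : ℝ → H →L[ℝ] H}
  {g : ℝ → H}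

/-- Writing the upper limit as an indicator fixes the interval of integration. Dominated convergence
then applies, since the integrand is continuous in `t` at `t₀` for every `s ≠ t₀`. -/
theorem continuousOn_duhamel_of_norm_le (hE : IsContractionSemigroup E)
    (hg : AEStronglyMeasurable g volume) {M : ℝ} (hM : ∀ s, ‖g s‖ ≤ M) (b : ℝ) :
    ContinuousOn (duhamel E g) (Icc 0 b) := by
  have hcont : Continuous fun t => ∫ s in (0 : ℝ)..b, (Iio t).indicator
      (fun s => E (t - s) (g s)) s := by
    refine continuous_iff_continuousAt.2 fun t₀ => ?_
    refine intervalIntegral.continuousAt_of_dominated_interval (bound := fun _ => M)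
      (Eventually.of_forall fun t => ?_) (Eventually.of_forall fun t => ae_of_all _ fun s _ => ?_)
      intervalIntegrable_const ?_
    · have h : AEStronglyMeasurable (fun s => E (t - s) (g s)) volume :=
        hE.continuous_uncurry.comp_aestronglyMeasurable
          ((by fun_prop : Continuous fun s : ℝ => t - s).aestronglyMeasurable.prodMk hg)
      exact (h.indicator measurableSet_Iio).restrict
    · exact (norm_indicator_le_norm_self _ _).trans ((hE.norm_le _ _).trans (hM s))
    · filter_upwards [Measure.ae_ne volume t₀] with s hs _
      rcases lt_or_gt_of_ne hs with h | h
      · have hc : ContinuousAt (fun t => E (t - s) (g s)) t₀ :=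
          (hE.continuous_comp (by fun_prop) continuous_const).continuousAt
        refine hc.congr ?_
        filter_upwards [lt_mem_nhds h] with t ht
        rw [indicator_of_mem (mem_Iio.2 ht)]
      · refine (continuousAt_const (y := (0 : H))).congr ?_
        filter_upwards [gt_mem_nhds h] with t ht
        rw [indicator_of_notMem (fun hh => lt_asymm ht (mem_Iio.1 hh))]
  refine hcont.continuousOn.congr fun t ht => ?_
  have hset : Ioc 0 b ∩ Iio t = Ioo 0 t := by
    ext s
    simp only [mem_inter_iff, mem_Ioc, mem_Iio, mem_Ioo]
    exact ⟨fun h => ⟨h.1.1, h.2⟩, fun h => ⟨⟨h.1, h.2.le.trans ht.2⟩, h.2⟩⟩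
  beta_reduce
  rw [duhamel, intervalIntegral.integral_of_le ht.1,
    intervalIntegral.integral_of_le (ht.1.trans ht.2), setIntegral_indicator measurableSet_Iio,
    hset, integral_Ioc_eq_integral_Ioo]

end BoundedDuhamel

/-! ### Uniqueness and global existence. -/

section Global

variable {H : Type*} [NormedAddCommGroup H] {r : ℝ≥0}

/-- Near every history, delays are frozen during a common time interval, which is short compared
to `1/K`. -/
def HasUniformStep (η : Hist r H → Icc (0 : ℝ) r) (K : ℝ) : Prop :=
  ∀ ψ₀ : Hist r H, ∃ δ, 0 < δ ∧ δ * K ≤ 1 / 2 ∧ ∀ᶠ ψ in 𝓝 ψ₀, LocallyFrozen η ψ δ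

theorem IgnoresOutside.hasUniformStep {η Θu Θl : Hist r H → Icc (0 : ℝ) r}
    (h : IgnoresOutside η Θu Θl) (hΘ : Continuous Θl) (hpos : ∀ φ, (0 : ℝ) < Θl φ) {K : ℝ}
    (hK : 0 ≤ K) : HasUniformStep η K := by
  intro ψ₀
  obtain ⟨δ, h1, h2, h3⟩ := h.exists_eventually_locallyFrozen hΘ hpos ψ₀
    (ε := 1 / (2 * (K + 1))) (by positivity)
  refine ⟨δ, h1, ?_, h3⟩
  rw [le_div_iff₀ (by positivity)] at h2
  linarith

variable [InnerProductSpace ℝ H] [CompleteSpace H]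
  {A : H →ₗ.[ℝ] H} {E : ℝ → H →L[ℝ] H} {d : ℝ} {B : H → H} {η : Hist r H → Icc (0 : ℝ) r}
  {L : ℝ≥0} {φ : Hist r H} {T b : ℝ} {u v w : ℝ → H}
  (hE : IsContractionSemigroup E) (hAE : ∀ t, 0 ≤ t → ∀ x, expNeg A t x = E t x)
  (hB : LipschitzWith L B) (hd : 0 ≤ d) (hη : Continuous η)
include hE hAE hB hd hη

/-- A mild solution on the half-open interval `[-r,b)` extends to the end point. -/
theorem exists_isMildSolutionOn_of_forall_lt (hb : 0 < b) (hbL : b * (L + d) ≤ 1 / 2)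
    (hw : ∀ T ∈ Ico 0 b, IsMildSolutionOn A d B η φ T w) :
    ∃ v, IsMildSolutionOn A d B η φ b v := by
  have hr := neg_coe_nonpos r
  have hgc : ContinuousOn (forcing d B η w) (Ico 0 b) := by
    intro s hs
    -- The midpoint leaves room to the right of `s`, so a globally continuous representative agrees
    -- with `w` near `s`.
    have hT : (s + b) / 2 ∈ Ico 0 b := ⟨by linarith [hs.1], by linarith [hs.2]⟩
    obtain ⟨w', hw', he, -⟩ := (hw _ hT).exists_continuous hT.1
    have h1 := (continuous_forcing (d := d) hB.continuous hη hw').continuousWithinAt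
      (s := Ico 0 b) (x := s)
    refine h1.congr_of_eventuallyEq ?_ (forcing_congr he ⟨hs.1, by linarith [hs.2]⟩).symm
    filter_upwards [self_mem_nhdsWithin, nhdsWithin_le_nhds
      (gt_mem_nhds (show s < (s + b) / 2 by linarith [hs.2]))] with t ht ht'
    exact (forcing_congr he ⟨ht.1, ht'.le⟩).symm
  set M : ℝ := 2 * (‖φ‖ + b * ‖B 0‖) with hM
  have hwM : ∀ s ∈ Ico 0 b, ∀ t ∈ Icc (-(r : ℝ)) s, ‖w t‖ ≤ M := fun s hs t ht => by
    have h1 : s * (L + d) ≤ 1 / 2 :=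
      (mul_le_mul_of_nonneg_right hs.2.le (add_nonneg L.2 hd)).trans hbL
    have h2 := (hw s hs).norm_le hE hAE hB hd hs.1 h1 t ht
    have h3 := mul_le_mul_of_nonneg_right hs.2.le (norm_nonneg (B 0))
    linarith
  have hM0 : 0 ≤ M := by positivity
  have hgM : ∀ s ∈ Ico 0 b, ‖forcing d B η w s‖ ≤ ‖B 0‖ + L * M + d * M := fun s hs => by
    have hη' := (η (segment r w s)).2
    rw [forcing, delayTerm_segment (hw s hs).1 ⟨hs.1, le_rfl⟩]
    have h1 := hB.norm_sub_le (w (s - η (segment r w s))) 0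
    have h2 := hwM s hs (s - η (segment r w s))
      ⟨by linarith [hη'.2, hs.1], by linarith [hη'.1]⟩
    have h3 := hwM s hs s ⟨by linarith [hs.1], le_rfl⟩
    have h4 := norm_le_norm_add_norm_sub' (B (w (s - η (segment r w s)))) (B 0)
    have h5 := mul_le_mul_of_nonneg_left h2 L.2
    have h6 := mul_le_mul_of_nonneg_left h3 hd
    rw [sub_zero] at h1
    simp only [NNReal.val_eq_coe] at h5
    refine (norm_sub_le _ _).trans ?_
    rw [norm_smul, Real.norm_of_nonneg hd]
    linarith
  -- Nothing is known about `w` at `b`. The cut-off forcing is bounded and measurable, so its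
  -- Duhamel integral is continuous up to `b` and supplies the missing value.
  set g : ℝ → H := (Ico 0 b).indicator (forcing d B η w) with hg
  have hgm : AEStronglyMeasurable g volume :=
    (aestronglyMeasurable_indicator_iff measurableSet_Ico).2
      (hgc.aestronglyMeasurable measurableSet_Ico)
  have hgb : ∀ s, ‖g s‖ ≤ ‖B 0‖ + L * M + d * M := fun s => by
    by_cases hs : s ∈ Ico 0 b
    · rw [hg, indicator_of_mem hs]
      exact hgM s hs
    · rw [hg, indicator_of_notMem hs, norm_zero]
      positivity
  set G : ℝ → H := fun t => E t (atZero φ) + duhamel E g t with hG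
  have hGc : ContinuousOn G (Icc 0 b) := (hE.continuous (atZero φ)).continuousOn.add
    (continuousOn_duhamel_of_norm_le hE hgm hgb b)
  have hwG : ∀ t ∈ Ico 0 b, w t = G t := fun t ht => by
    rw [((isMildSolutionOn_iff hAE).1 (hw t ht)).2.2 t ⟨ht.1, le_rfl⟩, hG]
    refine congrArg _ (duhamel_congr ht.1 fun s hs => ?_)
    rw [hg, indicator_of_mem (show s ∈ Ico 0 b from ⟨hs.1, hs.2.trans ht.2⟩)]
  set v : ℝ → H := fun t => if t < b then w t else G t with hv
  have hvw : ∀ t, t < b → v t = w t := fun t ht => if_pos ht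
  have hvG : EqOn v G (Icc 0 b) := fun t ht => by
    by_cases h : t < b
    · rw [hvw t h, hwG t ⟨ht.1, h⟩]
    · exact if_neg h
  have h0 := hw 0 ⟨le_rfl, hb⟩
  refine ⟨v, (isMildSolutionOn_iff hAE).2 ⟨?_, fun θ => ?_, fun t ht => ?_⟩⟩
  · rw [← Icc_union_Icc_eq_Icc hr hb.le]
    exact (h0.1.congr fun t ht => hvw t (ht.2.trans_lt hb)).union_of_isClosed (hGc.congr hvG)
      isClosed_Icc isClosed_Icc
  · rw [hvw θ (θ.2.2.trans_lt hb), h0.2]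
  · rw [hvG ht, hG]
    refine congrArg _ (duhamel_congr ht.1 fun s hs => ?_)
    have hsb := hs.2.trans_le ht.2
    rw [hg, indicator_of_mem (show s ∈ Ico 0 b from ⟨hs.1, hsb⟩)]
    exact forcing_congr (T := s) (fun x hx => (hvw x (hx.2.trans_lt hsb)).symm) ⟨hs.1, le_rfl⟩

variable (hstep : HasUniformStep η (L + d))
include hstep

/-- Agreement up to time `x` gives both translates the same history at `x`, hence the same frozen
delay; the error term vanishes and agreement extends past `x`. -/
theorem IsMildSolutionOn.eqOn (hu : IsMildSolutionOn A d B η φ T u)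
    (hv : IsMildSolutionOn A d B η φ T v) (hT : 0 ≤ T) : EqOn u v (Icc (-(r : ℝ)) T) := by
  have hr := neg_coe_nonpos r
  obtain ⟨u', hu', heu, hmu⟩ := hu.exists_continuous hT
  obtain ⟨v', hv', hev, hmv⟩ := hv.exists_continuous hT
  suffices h : EqOn u' v' (Icc (-(r : ℝ)) T) from fun t ht => by rw [← heu ht, ← hev ht, h ht]
  -- The truncation `min x t` turns "agreement up to `t`" into an intersection of closed conditions
  -- on `t`.
  set s : Set ℝ := {t | ∀ x, -(r : ℝ) ≤ x → u' (min x t) = v' (min x t)} with hs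
  have hcl : IsClosed s := by
    simp only [hs, ofPred_forall]
    exact isClosed_iInter fun x => isClosed_iInter fun _ =>
      isClosed_eq (by fun_prop) (by fun_prop)
  have hmem : ∀ t, 0 ≤ t → (t ∈ s ↔ EqOn u' v' (Icc (-(r : ℝ)) t)) := fun t ht =>
    ⟨fun h x hx => by simpa [min_eq_left hx.2] using h x hx.1,
      fun h x hx => h ⟨le_min hx (hr.trans ht), min_le_right _ _⟩⟩
  refine (hmem T hT).1 (IsClosed.Icc_subset_of_forall_exists_gt (hcl.inter isClosed_Icc) ?_ ?_
    ⟨hT, le_rfl⟩)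
  · exact (hmem 0 le_rfl).2 fun x hx => by rw [hmu.2 ⟨x, hx⟩, hmv.2 ⟨x, hx⟩]
  · rintro x ⟨hxs, hx0, hxT⟩ y hxy
    have hEq := (hmem x hx0).1 hxs
    obtain ⟨δ, hδ, hδL, hev⟩ := hstep (segment r u' x)
    have hfr := hev.self_of_nhds
    set c := min δ (min (T - x) (y - x)) with hc
    have hc0 : 0 < c := lt_min hδ (lt_min (by linarith) (by linarith [mem_Ioi.1 hxy]))
    have hc1 : c ≤ δ := min_le_left _ _
    have hc2 : c ≤ T - x := (min_le_right _ _).trans (min_le_left _ _)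
    have hc3 : c ≤ y - x := (min_le_right _ _).trans (min_le_right _ _)
    have hsu := (hmu.mono (a := x + c) (by linarith)).shift hE hAE hB.continuous hη hx0 hc0.le
    have hsv := (hmv.mono (a := x + c) (by linarith)).shift hE hAE hB.continuous hη hx0 hc0.le
    rw [← segment_congr hEq ⟨hx0, le_rfl⟩] at hsv
    have hle := norm_sub_le_of_locallyFrozen hE hAE hB hd hη hfr hfr hδL hc0.le hc1 hsu
      (by fun_prop) hsv
    simp only [sub_self, norm_zero, intervalIntegral.integral_zero, mul_zero, add_zero] at hle
    refine ⟨x + c, (hmem _ (by linarith)).2 fun t ht => ?_, by linarith, by linarith⟩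
    rcases le_total t x with htx | htx
    · exact hEq ⟨ht.1, htx⟩
    · have := sub_eq_zero.1 (norm_le_zero_iff.1 (hle (t - x) ⟨by linarith, by linarith [ht.2]⟩))
      simpa using this

/-- Mild solutions on different intervals are restrictions of a single function. -/
theorem exists_forall_isMildSolutionOn {J : Set ℝ} (h0 : ∀ T ∈ J, 0 ≤ T)
    (hJ : ∀ T ∈ J, ∀ t, 0 ≤ t → t ≤ T → t ∈ J)
    (h : ∀ T ∈ J, ∃ u, IsMildSolutionOn A d B η φ T u) :
    ∃ w, ∀ T ∈ J, IsMildSolutionOn A d B η φ T w := by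
  choose! U hU using h
  refine ⟨fun t => U (max t 0) t, fun T hT => (hU T hT).congr (h0 T hT) fun t ht => ?_⟩
  have h1 : max t 0 ≤ T := max_le ht.2 (h0 T hT)
  have h2 : max t 0 ∈ J := hJ T hT _ (le_max_right _ _) h1
  exact IsMildSolutionOn.eqOn hE hAE hB hd hη hstep (hU _ h2) ((hU T hT).mono h1)
    (le_max_right _ _) ⟨ht.1, le_max_left _ _⟩

/-- If existence times were bounded, their supremum `a` would be attained, and a further local step
would exceed it. -/
theorem exists_isMildSolutionOn (φ : Hist r H) (hT : 0 ≤ T) :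
    ∃ u, IsMildSolutionOn A d B η φ T u := by
  set J : Set ℝ := {T | 0 ≤ T ∧ ∃ u, IsMildSolutionOn A d B η φ T u} with hJ
  have hlocal : ∀ ψ : Hist r H, ∃ δ, 0 < δ ∧ δ * (L + d) ≤ 1 / 2 ∧
      ∃ u, IsMildSolutionOn A d B η ψ δ u := fun ψ => by
    obtain ⟨δ, hδ, hδL, hev⟩ := hstep ψ
    exact ⟨δ, hδ, hδL, hev.self_of_nhds.exists_isMildSolutionOn hE hAE hB hd hη hδ.le hδL⟩
  have hdown : ∀ T ∈ J, ∀ t, 0 ≤ t → t ≤ T → t ∈ J := fun T hT t ht htT =>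
    ⟨ht, hT.2.imp fun u hu => hu.mono htT⟩
  obtain ⟨h₀, hh₀, hh₀L, u₀, hu₀⟩ := hlocal φ
  have h0J : h₀ ∈ J := ⟨hh₀.le, u₀, hu₀⟩
  by_contra hcon
  have hTJ : T ∉ J := fun h => hcon h.2
  have hbdd : BddAbove J := ⟨T, fun t ht => by
    by_contra hlt
    exact hTJ (hdown t ht T hT (not_le.1 hlt).le)⟩
  set a := sSup J with ha
  have ha0 : h₀ ≤ a := le_csSup hbdd h0J
  have hlt : ∀ t, 0 ≤ t → t < a → t ∈ J := fun t ht hta => by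
    obtain ⟨t', ht', htt'⟩ := exists_lt_of_lt_csSup ⟨_, h0J⟩ hta
    exact hdown t' ht' t ht htt'.le
  obtain ⟨w, hw⟩ := exists_forall_isMildSolutionOn hE hAE hB hd hη hstep (φ := φ)
    (fun T hT => hT.1) hdown (fun T hT => hT.2)
  have haJ : ∃ u, IsMildSolutionOn A d B η φ a u := by
    -- Restarting at `a - h₀` leaves an interval of length `h₀`, short enough for the a priori bound
    -- used in reaching the end point.
    have ha' : 0 ≤ a - h₀ := sub_nonneg.2 ha0
    have hwa := hw _ (hlt (a - h₀) ha' (by linarith))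
    obtain ⟨v, hv⟩ := exists_isMildSolutionOn_of_forall_lt hE hAE hB hd hη hh₀ hh₀L
      (φ := segment r w (a - h₀)) (w := fun t => w (a - h₀ + t)) fun t ht =>
        (hw _ (hlt (a - h₀ + t) (by linarith [ht.1]) (by linarith [ht.2]))).shift hE hAE
          hB.continuous hη ha' ht.1
    have := hwa.exists_concat hE hAE hB.continuous hη hv ha' hh₀.le
    rwa [sub_add_cancel] at this
  obtain ⟨u, hu⟩ := haJ
  obtain ⟨δ, hδ, -, v, hv⟩ := hlocal (segment r u a)
  have hmem : a + δ ∈ J :=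
    ⟨by linarith, hu.exists_concat hE hAE hB.continuous hη hv (hh₀.le.trans ha0) hδ.le⟩
  linarith [le_csSup hbdd hmem]

theorem exists_isGlobalMildSolution (φ : Hist r H) :
    ∃ u, Continuous u ∧ IsGlobalMildSolution A d B η φ u := by
  have hr := neg_coe_nonpos r
  obtain ⟨w, hw⟩ := exists_forall_isMildSolutionOn hE hAE hB hd hη hstep (φ := φ) (J := Ici 0)
    (fun _ h => h) (fun _ _ _ h _ => h)
    (fun T hT => exists_isMildSolutionOn hE hAE hB hd hη hstep φ hT)
  have hc : ContinuousOn w (Ici (-(r : ℝ))) := fun t ht => by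
    have h1 : 0 ≤ max t 0 + 1 := by positivity
    refine ((hw _ h1).1 t ⟨ht, by linarith [le_max_left t 0]⟩).mono_of_mem_nhdsWithin ?_
    rw [← Ici_inter_Iic]
    exact inter_mem_nhdsWithin _ (Iic_mem_nhds (by linarith [le_max_left t 0]))
  have hw' : ∀ T, EqOn (fun t => w (max t (-(r : ℝ)))) w (Icc (-(r : ℝ)) T) := fun T t ht => by
    simp only [max_eq_left ht.1]
  have hc' : Continuous fun t => w (max t (-(r : ℝ))) :=
    hc.comp_continuous (by fun_prop) fun t => mem_Ici.2 (le_max_right _ _)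
  exact ⟨_, hc', hc'.continuousOn, fun T hT => (hw T hT).congr hT (hw' T)⟩

end Global

/-- A semiflow whose time-`t` maps are continuous for locally uniformly small times has continuous
time-`t` maps for all times. -/
theorem continuous_of_eventually_continuousAt {X : Type*} [TopologicalSpace X] {S : ℝ≥0 → X → X}
    (zero : S 0 = id) (add : ∀ t τ : ℝ≥0, S t ∘ S τ = S (t + τ))
    (htime : ∀ x : X, Continuous (fun t : ℝ≥0 => S t x))
    (h : ∀ x₀, ∃ δ : ℝ≥0, 0 < δ ∧ ∀ᶠ x in 𝓝 x₀, ∀ t ≤ δ, ContinuousAt (S t) x) (t : ℝ≥0) :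
    Continuous (S t) := by
  refine continuous_iff_continuousAt.2 fun x => ?_
  set s : Set ℝ≥0 := {t | ∀ τ ≤ t, ContinuousAt (S τ) x} with hs
  have h0 : (0 : ℝ≥0) ∈ s := fun τ hτ => by
    rw [nonpos_iff_eq_zero.1 hτ, zero]
    exact continuousAt_id
  by_contra hcon
  have hbdd : BddAbove s := ⟨t, fun τ hτ => by
    by_contra hlt
    exact hcon (hτ t (not_le.1 hlt).le)⟩
  set a := sSup s with ha
  obtain ⟨δ, hδ, hev⟩ := h (S a x)
  have hev' : ∀ᶠ τ in 𝓝 a, (∀ t ≤ δ, ContinuousAt (S t) (S τ x)) ∧ a < τ + δ :=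
    ((htime x).tendsto a |>.eventually hev).and
      (((by fun_prop : Continuous fun τ : ℝ≥0 => τ + δ).tendsto a).eventually_const_lt
        (lt_add_of_pos_right a hδ))
  -- The supremum `a` need not be known to lie in `s`, so `τ` is taken just below it unless `a = 0`.
  -- As `S τ x` is near `S a x`, the step `δ` remains valid there and carries past `a`.
  obtain ⟨τ, hτ, hτs⟩ : ∃ τ, ((∀ t ≤ δ, ContinuousAt (S t) (S τ x)) ∧ a < τ + δ) ∧ τ ∈ s := by
    rcases eq_or_lt_of_le (zero_le : (0 : ℝ≥0) ≤ a) with h | h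
    · exact ⟨a, hev'.self_of_nhds, h ▸ h0⟩
    · have : (𝓝[<] a).NeBot := nhdsLT_neBot_of_exists_lt ⟨0, h⟩
      obtain ⟨τ, hτ, hτa⟩ := ((hev'.filter_mono nhdsWithin_le_nhds).and
        (self_mem_nhdsWithin : Iio a ∈ 𝓝[<] a)).exists
      obtain ⟨t', ht', htt'⟩ := exists_lt_of_lt_csSup ⟨_, h0⟩ hτa
      exact ⟨τ, hτ, fun σ hσ => ht' σ (hσ.trans htt'.le)⟩
  refine absurd (le_csSup hbdd (a := τ + δ) fun σ hσ => ?_) (not_le.2 hτ.2)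
  rcases le_total σ τ with hστ | hστ
  · exact hτs σ hστ
  · have := add (σ - τ) τ
    rw [tsub_add_cancel_of_le hστ] at this
    rw [← this]
    exact (hτ.1 (σ - τ) (tsub_le_iff_left.2 hσ)).comp (hτs τ le_rfl)

/-! ### The dynamical system. -/

section Flow

variable {H : Type*} [NormedAddCommGroup H] [InnerProductSpace ℝ H] [CompleteSpace H] {r : ℝ≥0}
  {A : H →ₗ.[ℝ] H} {E : ℝ → H →L[ℝ] H} {d : ℝ} {B : H → H} {η : Hist r H → Icc (0 : ℝ) r}
  {L : ℝ≥0}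
  (hE : IsContractionSemigroup E) (hAE : ∀ t, 0 ≤ t → ∀ x, expNeg A t x = E t x)
  (hB : LipschitzWith L B) (hd : 0 ≤ d) (hη : Continuous η)
include hE hAE hB hd hη

theorem LocallyFrozen.continuousAt_segment {U : Hist r H → ℝ → H} (hUc : ∀ φ, Continuous (U φ))
    (hU : ∀ φ, IsGlobalMildSolution A d B η φ (U φ)) {ψ : Hist r H} {δ t : ℝ}
    (hψ : ∀ᶠ χ in 𝓝 ψ, LocallyFrozen η χ δ) (hδL : δ * (L + d) ≤ 1 / 2) (ht : 0 ≤ t)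
    (htδ : t ≤ δ) : ContinuousAt (fun φ => segment r (U φ) t) ψ := by
  -- The reference solution `U ψ` is fixed, so only the frozen delay of `χ` varies in the integral.
  -- Continuity of `η` and `U ψ` makes `R` continuous, with `R ψ = 0`.
  set R : Hist r H → ℝ := fun χ => 2 * (‖ψ - χ‖ + L * ∫ s in (0 : ℝ)..t,
      ‖U ψ (s - η (freeze ψ s)) - U ψ (s - η (freeze χ s))‖) with hR
  have hRc : Continuous R := by
    have h1 : Continuous fun p : Hist r H × ℝ => (η (freeze p.1 p.2) : ℝ) :=
      continuous_subtype_val.comp (hη.comp continuous_freeze)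
    have h2 : Continuous fun p : Hist r H × ℝ => (η (freeze ψ p.2) : ℝ) :=
      h1.comp (continuous_const.prodMk continuous_snd)
    have h3 : Continuous fun χ : Hist r H => ∫ s in (0 : ℝ)..t,
        ‖U ψ (s - η (freeze ψ s)) - U ψ (s - η (freeze χ s))‖ := by
      refine intervalIntegral.continuous_parametric_intervalIntegral_of_continuous' ?_ 0 t
      exact (((hUc ψ).comp (continuous_snd.sub h2)).sub
        ((hUc ψ).comp (continuous_snd.sub h1))).norm
    simp only [hR]
    fun_prop
  have hR0 : R ψ = 0 := by simp [hR]
  refine tendsto_iff_norm_sub_tendsto_zero.2 (squeeze_zero' (g := R)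
    (Eventually.of_forall fun _ => norm_nonneg _) ?_ (by
      simpa only [hR0] using hRc.tendsto ψ))
  filter_upwards [hψ] with χ hχ
  have hle := norm_sub_le_of_locallyFrozen hE hAE hB hd hη hψ.self_of_nhds hχ hδL ht htδ
    ((hU ψ).2 t ht) (hUc ψ) ((hU χ).2 t ht)
  have hR' : 0 ≤ R χ := (norm_nonneg _).trans (hle t ⟨(neg_coe_nonpos r).trans ht, le_rfl⟩)
  rw [ContinuousMap.norm_le _ hR']
  intro θ
  rw [ContinuousMap.sub_apply, segment_apply_of_continuous (hUc χ),
    segment_apply_of_continuous (hUc ψ), norm_sub_rev]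
  exact hle _ ⟨by linarith [θ.2.1], by linarith [θ.2.2]⟩

variable (hstep : HasUniformStep η (L + d))
include hstep

theorem IsGlobalMildSolution.segment_eq {φ : Hist r H} {u v : ℝ → H}
    (hu : IsGlobalMildSolution A d B η φ u) (hv : IsGlobalMildSolution A d B η φ v) {t : ℝ}
    (ht : 0 ≤ t) : segment r u t = segment r v t :=
  segment_congr ((hu.2 t ht).eqOn hE hAE hB hd hη hstep (hv.2 t ht) ht) ⟨ht, le_rfl⟩

theorem exists_isDynamicalSystem : ∃ S : ℝ≥0 → Hist r H → Hist r H,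
    (∀ φ u, IsGlobalMildSolution A d B η φ u → ∀ t : ℝ≥0, S t φ = segment r u t) ∧
      IsDynamicalSystem S := by
  choose U hUc hU using exists_isGlobalMildSolution hE hAE hB hd hη hstep
  have hzero : (fun φ => segment r (U φ) ((0 : ℝ≥0) : ℝ)) = id :=
    funext fun φ => ((hU φ).2 0 le_rfl).segment_zero le_rfl
  have hadd : ∀ t τ : ℝ≥0,
      (fun φ => segment r (U φ) (t : ℝ)) ∘ (fun φ => segment r (U φ) (τ : ℝ)) =
      fun φ => segment r (U φ) ((t + τ : ℝ≥0) : ℝ) := fun t τ => funext fun φ => by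
    have hτ : (0 : ℝ) ≤ τ := τ.2
    -- The translate solves the problem with initial history `S_τ φ`; uniqueness turns this into the
    -- semigroup law.
    have hshift : IsGlobalMildSolution A d B η (segment r (U φ) τ) (fun s => U φ (τ + s)) :=
      ⟨((hUc φ).comp (by fun_prop)).continuousOn, fun T hT =>
        ((hU φ).2 (τ + T) (add_nonneg hτ hT)).shift hE hAE hB.continuous hη hτ hT⟩
    rw [Function.comp_apply, (hU _).segment_eq hE hAE hB hd hη hstep hshift t.coe_nonneg,
      segment_shift, NNReal.coe_add, add_comm]
  have htime : ∀ φ, Continuous fun t : ℝ≥0 => segment r (U φ) (t : ℝ) := fun φ =>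
    (continuous_segment (hUc φ)).comp NNReal.continuous_coe
  refine ⟨fun t φ => segment r (U φ) t,
    fun φ u hu t => (hU φ).segment_eq hE hAE hB hd hη hstep hu t.coe_nonneg, hzero, hadd, htime, ?_⟩
  refine continuous_of_eventually_continuousAt hzero hadd htime fun ψ₀ => ?_
  obtain ⟨δ, hδ, hδL, hev⟩ := hstep ψ₀
  refine ⟨⟨δ, hδ.le⟩, hδ, ?_⟩
  -- Continuity at `ψ` compares it with its neighbours, so the common `δ` must hold in a
  -- neighbourhood of each `ψ` near `ψ₀`.
  filter_upwards [eventually_eventually_nhds.2 hev] with ψ hψ t ht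
  exact LocallyFrozen.continuousAt_segment hE hAE hB hd hη hUc hU hψ hδL t.2 ht

end Flow

end DelayEq

end

theorem theorem1 {n₀ : ℕ} (Ω : Set (EuclideanSpace ℝ (Fin n₀)))
    (hΩ_open : IsOpen Ω) (hΩ_conn : IsConnected Ω) (hΩ_bdd : Bornology.IsBounded Ω)
    (A : Lp ℝ 2 (volume.restrict Ω) →ₗ.[ℝ] Lp ℝ 2 (volume.restrict Ω))
    (hA_dense : Dense (A.domain : Set (Lp ℝ 2 (volume.restrict Ω))))
    (hA_sa : IsSelfAdjoint A) (hA_pos : DelayEq.IsPositiveOp A)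
    (hA_comp : DelayEq.HasCompactResolvent A)
    (d : ℝ) (hd : 0 ≤ d) (r : ℝ≥0) (hr : 0 < r)
    (B : Lp ℝ 2 (volume.restrict Ω) → Lp ℝ 2 (volume.restrict Ω))
    (L_B : ℝ≥0) (hB : LipschitzWith L_B B)
    (Θu Θl η : DelayEq.Hist r (Lp ℝ 2 (volume.restrict Ω)) → Icc (0 : ℝ) r)
    (hΘu : Continuous Θu) (hΘl : Continuous Θl)
    (hΘ_le : ∀ φ, Θl φ ≤ Θu φ) (hΘl_pos : ∀ φ, (0 : ℝ) < Θl φ)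
    (hη : Continuous η) (hη_ign : DelayEq.IgnoresOutside η Θu Θl) :
    (∀ φ : DelayEq.Hist r (Lp ℝ 2 (volume.restrict Ω)),
      ∃ u : ℝ → Lp ℝ 2 (volume.restrict Ω),
        DelayEq.IsGlobalMildSolution A d B η φ u ∧
        ∀ (T : ℝ) (v : ℝ → Lp ℝ 2 (volume.restrict Ω)), 0 ≤ T →
          DelayEq.IsMildSolutionOn A d B η φ T v → EqOn v u (Icc (-(r : ℝ)) T)) ∧
    ∃ S : ℝ≥0 → DelayEq.Hist r (Lp ℝ 2 (volume.restrict Ω)) →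
        DelayEq.Hist r (Lp ℝ 2 (volume.restrict Ω)),
      (∀ φ u, DelayEq.IsGlobalMildSolution A d B η φ u →
        ∀ t : ℝ≥0, S t φ = DelayEq.segment r u t) ∧
      DelayEq.IsDynamicalSystem S := by
  have hA : A.IsFormalAdjoint A := by
    have h := LinearPMap.adjoint_isFormalAdjoint hA_dense
    rwa [LinearPMap.isSelfAdjoint_def.1 hA_sa] at h
  have hE := DelayEq.isContractionSemigroup_expNegCLM hA hA_pos hA_comp
  have hAE : ∀ t, 0 ≤ t → ∀ x, DelayEq.expNeg A t x = DelayEq.expNegCLM hA hA_pos t x :=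
    fun t ht x => (DelayEq.expNegCLM_apply hA hA_pos ht x).symm
  have hstep := hη_ign.hasUniformStep hΘl hΘl_pos (add_nonneg L_B.2 hd)
  refine ⟨fun φ => ?_, DelayEq.exists_isDynamicalSystem hE hAE hB hd hη hstep⟩
  obtain ⟨u, -, hu⟩ := DelayEq.exists_isGlobalMildSolution hE hAE hB hd hη hstep φ
  exact ⟨u, hu, fun T v hT hv => hv.eqOn hE hAE hB hd hη hstep (hu.2 T hT) hT⟩
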